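/- Let $N,m,n_0$ be nonnegative integers, $S\in\mathbb R^{m\times m}$, and let $\bar{\mathcal G}_1,\dots,\bar{\mathcal G}_{n_0}$ be digraphs on the nodes $\{0,1,\dots,N\}$ (node $0$ is the leader, nodes $1,\dots,N$ are the followers) with weighted adjacency matrices $\bar{\mathcal A}_p=[a^{p}_{ij}]_{i,j=0}^N$, that is, $a^p_{ii}=0$, $a^p_{ij}\ge 0$, and $a^p_{ij}>0$ if and only if $(j,i)$ is an edge of $\bar{\mathcal G}_p$ (an edge from $j$ to $i$). Let $\sigma:[0,\infty)\to\{1,\dots,n_0\}$ be a piecewise constant switching signal: there are instants $t_0=0$, $t_{i+1}-t_i\ge\tau_0$ for some $\tau_0>0$, with $\sigma$ constant on each $[t_i,t_{i+1})$. Put $a_{ij}(t)=a^{\sigma(t)}_{ij}$. Assume: (i) no eigenvalue of $S$ has positive real part; (ii) (joint connectivity) there are indices $i_0<i_1<i_2<\cdots$ and $\epsilon>0$ such that for all $k$, $t_{i_{k+1}}-t_{i_k}<\epsilon$ and every node $1,\dots,N$ is reachable by a directed path from node $0$ in the union digraph $\bigcup_{j=i_k}^{i_{k+1}-1}\bar{\mathcal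 G}_{\sigma(t_j)}$. Let $\mu_1,\mu_2>0$ and consider the leader $\dot v=Sv$, $v(t)\in\mathbb R^m$, and the adaptive distributed observer, for $i=1,\dots,N$, $$\dot S_i=\mu_1\sum_{j=0}^N a_{ij}(t)(S_j-S_i),\qquad \dot\eta_i=S_i\eta_i+\mu_2\sum_{j=0}^N a_{ij}(t)(\eta_j-\eta_i),$$ where $S_i(t)\in\mathbb R^{m\times m}$, $\eta_i(t)\in\mathbb R^m$, $S_0=S$, $\eta_0=v$; solutions are continuous on $[0,\infty)$ and satisfy the equations with right derivatives at every $t\ge 0$. Let $\hat S_i=S_i-S$, let $\hat S=\mathrm{col}(\hat S_1,\dots,\hat S_N)$ be the $Nm\times m$ block column of these matrices, $\hat\eta_i=\eta_i-v$, and let $\|\cdot\|$ be the matrix norm induced by the Euclidean norm. Then $\hat S$ tends to $0$ exponentially: there are constants $c,\lambda>0$, independent of the initial conditions, such that for every solution on $[0,\infty)$, whatever the initial values $v(0),S_i(0),\eta_i(0)$, $$\|\hat S(t)\|\le c\,\|\hat S(0)\|\,e^{-\lambda t}\quad\text{for all } t\ge 0,$$ and, for every such solution, $\lim_{t\to+\infty}\hat\eta_i(t)=0$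 for $i=1,\dots,N$. -/

import Mathlib

open Set Filter Topology
open scoped Matrix
-- On real matrices, the norm is the one induced by the Euclidean norm.
open scoped Matrix.Norms.L2Operator

/-- `σ`, restricted to `[0, ∞)`, is a piecewise constant switching signal with switching
instants `t 0 = 0 < t 1 < t 2 < …` and some positive dwell time `τ₀`. -/
structure IsSwitchingSignal {P : Type*} (σ : ℝ → P) (t : ℕ → ℝ) : Prop where
  start : t 0 = 0
  dwell : ∃ τ₀ : ℝ, 0 < τ₀ ∧ ∀ i, τ₀ ≤ t (i + 1) - t i
  const : ∀ i, ∀ s ∈ Ico (t i) (t (i + 1)), σ s = σ (t i)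

/-- `A = [a i j]` is a weighted adjacency matrix of the digraph `G`: it is nonnegative with zero
diagonal, and `a i j > 0` exactly when there is an edge from `j` to `i`. -/
structure IsWeightedAdjacency {V : Type*} (G : Digraph V) (A : Matrix V V ℝ) : Prop where
  diag : ∀ i, A i i = 0
  nonneg : ∀ i j, 0 ≤ A i j
  pos_iff : ∀ i j, 0 < A i j ↔ G.Adj j i

/-- There is a directed path (a nonempty finite sequence of consecutive edges) from `a` to `b`. -/
def Digraph.IsReachable {V : Type*} (G : Digraph V) (a b : V) : Prop :=
  Relation.TransGen G.Adj a b

/-- The jointly connected condition: along some subsequence `ι` of the switching instants whose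
gaps are less than some `ε > 0`, every node other than the leader (node `0`) is reachable from the
leader in the union of the digraphs active on the time window `[t (ι k), t (ι (k + 1)))`. -/
def IsJointlyConnected {N : ℕ} {P : Type*} (G : P → Digraph (Fin (N + 1)))
    (σ : ℝ → P) (t : ℕ → ℝ) : Prop :=
  ∃ ι : ℕ → ℕ, StrictMono ι ∧
    (∃ ε : ℝ, 0 < ε ∧ ∀ k, t (ι (k + 1)) - t (ι k) < ε) ∧
    ∀ k, ∀ i : Fin (N + 1), i ≠ 0 →
      (⨆ j ∈ Finset.Ico (ι k) (ι (k + 1)), G (σ (t j))).IsReachable 0 i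

/-- No (complex) eigenvalue of the real square matrix `S` has positive real part. -/
def NoEigenvalueWithPosRe {m : ℕ} (S : Matrix (Fin m) (Fin m) ℝ) : Prop :=
  ∀ z : ℂ, Module.End.HasEigenvalue (Matrix.toLin' (S.map (algebraMap ℝ ℂ))) z → z.re ≤ 0

/-- `x` solves `x' = f s x` on `[0, ∞)`: it is continuous there and has right derivative
`f s (x s)` at each `s ≥ 0`. When `s ↦ f s (x s)` is continuous on each interval between
consecutive switching instants (closed on the left), this says that `x` is continuous and is a
classical `C¹` solution on each of these intervals. -/
def IsSolution {E : Type*} [NormedAddCommGroup E] [NormedSpace ℝ E]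
    (f : ℝ → E → E) (x : ℝ → E) : Prop :=
  ContinuousOn x (Ici 0) ∧ ∀ s, 0 ≤ s → HasDerivWithinAt x (f s (x s)) (Ici s) s

/-- The leader system `v' = S v` together with the adaptive distributed observer
`(S i)' = μ₁ ∑ j, a i j (S j - S i)`,
`(η i)' = S i (η i) + μ₂ ∑ j, a i j (η j - η i)`,
where follower `i : Fin N` is node `i.succ`, the sums run over all nodes `j = 0, …, N`, and the
values at the leader node `0` are `S` and `v` (this is what `Fin.cons` does).
The matrix `a s` holds the weights at time `s`; `X i` is the estimate of `S` by follower `i`. -/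
structure IsObserverTrajectory {N m : ℕ} (a : ℝ → Matrix (Fin (N + 1)) (Fin (N + 1)) ℝ)
    (μ₁ μ₂ : ℝ) (S : Matrix (Fin m) (Fin m) ℝ) (v : ℝ → Fin m → ℝ)
    (X : Fin N → ℝ → Matrix (Fin m) (Fin m) ℝ) (η : Fin N → ℝ → Fin m → ℝ) : Prop where
  leader : IsSolution (fun _ x => S *ᵥ x) v
  estimate : ∀ i, IsSolution (fun s Y => μ₁ • ∑ j : Fin (N + 1),
    a s i.succ j • ((Fin.cons S fun k => X k s : Fin (N + 1) → Matrix (Fin m) (Fin m) ℝ) j - Y))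
    (X i)
  observer : ∀ i, IsSolution (fun s x => X i s *ᵥ x + μ₂ • ∑ j : Fin (N + 1),
    a s i.succ j • ((Fin.cons (v s) fun k => η k s : Fin (N + 1) → Fin m → ℝ) j - x))
    (η i)

/-- The block column `col (X 1, …, X N)`. -/
def blockCol {N m : ℕ} (X : Fin N → Matrix (Fin m) (Fin m) ℝ) :
    Matrix (Fin N × Fin m) (Fin m) ℝ :=
  Matrix.of fun p b => X p.1 p.2 b

/-!
Each entry of the estimation errors `X i - S` solves a scalar consensus system with the leader
fixed at `0`. The minimum principle `IsSupersolution.nonneg` turns a two-sided bound `M` on the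
states into a nonnegative supersolution whose leader has the value `M`. Such values persist up to a
factor bounded below and are passed along active edges, and joint connectivity supplies, within a
bounded time, an edge out of any proper set of nodes that contains the leader
(`IsJointlyConnected.isCutExcited`). So the set of nodes with a value bounded below exhausts the
network after finitely many windows (`IsSupersolution.exists_spread`). Hence the errors shrink by a
fixed factor over a fixed time, uniformly in the initial time, which gives
`exists_hasConsensusBound` and the exponential decay of `X - S`. The bound tolerates a
disturbance, because a disturbance of size at most `γ` is compensated by adding `γ (s - s₀)` to the
states.

The observation error `e i = η i - v` satisfies
`(e i)' = S (e i) + μ₂ ∑ j, a i j (e j - e i) + (X i - S) (η i)`. Its drift `S` commutes with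
the consensus part, so on a window starting at `s₀` the functions `exp (-(s - s₀) S) (e i)` again
solve a disturbed consensus system. Since no eigenvalue of `S` has positive real part, the flow of
`S` grows more slowly than any increasing exponential
(`NoEigenvalueWithPosRe.exists_norm_solution_le`), by the decomposition of the complexified space
into generalized eigenspaces. This has two uses: over a long enough window the consensus decay
beats the growth of the flow, and the disturbance `(X i - S) (η i)` is exponentially small relative
to `‖e‖ + 1`. Therefore `e` contracts over each window up to a vanishing error, and it tends to zero
(`tendsto_zero_of_vanishing_disturbance`).
-/

/-! ### Supersolutions of a time-varying consensus system -/

/-- On `[s₀, s₁]` the functions `y i` satisfy `(y i)' ≥ ∑ j, b s i j * (y j - y i)`, with right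
derivatives. -/
structure IsSupersolution {V : Type*} [Fintype V] (b : ℝ → V → V → ℝ) (y : V → ℝ → ℝ)
    (s₀ s₁ : ℝ) : Prop where
  cont : ∀ i, ContinuousOn (y i) (Icc s₀ s₁)
  deriv : ∀ i, ∀ s ∈ Ico s₀ s₁, ∃ d, HasDerivWithinAt (y i) d (Ici s) s ∧
    ∑ j, b s i j * (y j s - y i s) ≤ d

/-- In every time window of length `h`, every cut of the nodes that has `r` on its near side is
crossed by an edge whose weight is at least `β` during a subinterval of length `τ`. The weight
`b s i j` is that of the edge from `j` to `i`. -/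
def IsCutExcited {V : Type*} [Fintype V] (b : ℝ → V → V → ℝ) (r : V) (h τ β : ℝ) : Prop :=
  ∀ s₀, 0 ≤ s₀ → ∀ P : Finset V, r ∈ P → P ≠ Finset.univ → ∃ i ∉ P, ∃ j ∈ P, ∃ u,
    s₀ ≤ u ∧ u + τ ≤ s₀ + h ∧ ∀ s ∈ Ico u (u + τ), β ≤ b s i j

section Supersolution

variable {V : Type*} [Fintype V] {b : ℝ → V → V → ℝ} {y : V → ℝ → ℝ} {s₀ s₁ : ℝ}

lemma IsSupersolution.mono (hy : IsSupersolution b y s₀ s₁) {u₀ u₁ : ℝ} (h₀ : s₀ ≤ u₀)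
    (h₁ : u₁ ≤ s₁) : IsSupersolution b y u₀ u₁ where
  cont i := (hy.cont i).mono (Icc_subset_Icc h₀ h₁)
  deriv i s hs := hy.deriv i s ⟨h₀.trans hs.1, hs.2.trans_le h₁⟩

lemma IsSupersolution.add_const (hy : IsSupersolution b y s₀ s₁) (M : ℝ) :
    IsSupersolution b (fun i s => y i s + M) s₀ s₁ where
  cont i := (hy.cont i).add continuousOn_const
  deriv i s hs := by
    obtain ⟨d, hd, hle⟩ := hy.deriv i s hs
    exact ⟨d, hd.add_const M, by simpa using hle⟩

/-- A continuous function stays above a line of slope less than its right derivative just after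
they meet. -/
lemma HasDerivWithinAt.eventually_line_le {f : ℝ → ℝ} {d k s : ℝ}
    (hf : HasDerivWithinAt f d (Ici s) s) (hk : k < d) :
    ∀ᶠ u in 𝓝[>] s, f s + k * (u - s) ≤ f u := by
  have h := (hasDerivWithinAt_iff_tendsto_slope' (lt_irrefl s)).1 hf.Ioi_of_Ici
  filter_upwards [h.eventually (lt_mem_nhds hk), self_mem_nhdsWithin] with u hu hsu
  have hpos : 0 < u - s := sub_pos.2 hsu
  rw [slope_def_field, lt_div_iff₀ hpos] at hu
  linarith

/-- Minimum principle: wherever the least of the `y i` touches the barrier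
`-κ (1 + (s - s₀))`, its right derivative is nonnegative, so the barrier is never crossed. -/
theorem IsSupersolution.nonneg (hy : IsSupersolution b y s₀ s₁)
    (hb : ∀ s ∈ Ico s₀ s₁, ∀ i j, 0 ≤ b s i j) (h0 : ∀ i, 0 ≤ y i s₀) :
    ∀ s ∈ Icc s₀ s₁, ∀ i, 0 ≤ y i s := by
  have key : ∀ κ : ℝ, 0 < κ → ∀ s ∈ Icc s₀ s₁, ∀ i, -(κ * (1 + (s - s₀))) ≤ y i s := by
    intro κ hκ
    refine IsClosed.Icc_subset_of_forall_mem_nhdsWithin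
      (s := {s | ∀ i, -(κ * (1 + (s - s₀))) ≤ y i s}) ?_ ?_ ?_
    · have : {s | ∀ i, -(κ * (1 + (s - s₀))) ≤ y i s} ∩ Icc s₀ s₁
          = Icc s₀ s₁ ∩ ⋂ i, {s ∈ Icc s₀ s₁ | -(κ * (1 + (s - s₀))) ≤ y i s} := by
        ext s
        simp only [mem_inter_iff, mem_ofPred_eq, mem_iInter]
        exact ⟨fun hs => ⟨hs.2, fun i => ⟨hs.2, hs.1 i⟩⟩, fun hs => ⟨fun i => (hs.2 i).2, hs.1⟩⟩
      rw [this]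
      exact isClosed_Icc.inter (isClosed_iInter fun i =>
        isClosed_Icc.isClosed_le (by fun_prop) (hy.cont i))
    · intro i
      have := h0 i
      simp only [sub_self]
      linarith
    · rintro s ⟨hs, hsI⟩
      refine eventually_all.2 fun i => ?_
      obtain ⟨d, hd, hle⟩ := hy.deriv i s hsI
      rcases (hs i).lt_or_eq with hlt | heq
      · have hc : Tendsto (y i) (𝓝[>] s) (𝓝 (y i s)) :=
          hd.continuousWithinAt.mono Ioi_subset_Ici_self
        have hl : Tendsto (fun u => -(κ * (1 + (u - s₀)))) (𝓝[>] s)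
            (𝓝 (-(κ * (1 + (s - s₀))))) :=
          (Continuous.tendsto (by fun_prop) s).mono_left nhdsWithin_le_nhds
        filter_upwards [hl.eventually_lt hc hlt] with u hu using hu.le
      · have hd0 : 0 ≤ d := by
          refine le_trans (Finset.sum_nonneg fun j _ => mul_nonneg (hb s hsI i j) ?_) hle
          have := hs j
          linarith
        filter_upwards [hd.eventually_line_le (show -κ < d by linarith)] with u hu
        linarith
  intro s hs i
  by_contra hneg
  push Not at hneg
  have hpos : 0 < 1 + (s - s₀) := by linarith [hs.1]
  have := key (-(y i s) / (2 * (1 + (s - s₀)))) (by apply div_pos <;> linarith) s hs i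
  have e : -(y i s) / (2 * (1 + (s - s₀))) * (1 + (s - s₀)) = -(y i s) / 2 := by
    field_simp
  rw [e] at this
  linarith

/-- If `f' ≥ -D f + k`, with `D ≥ 0` and `k ≥ 0`, then
`f s ≥ (f u₀ + k (s - u₀)) e^{-D (s - u₀)}`. -/
lemma le_of_neg_mul_add_le_deriv_right {f f' : ℝ → ℝ} {D k u₀ u₁ : ℝ} (hD : 0 ≤ D) (hk : 0 ≤ k)
    (hf : ContinuousOn f (Icc u₀ u₁))
    (hf' : ∀ s ∈ Ico u₀ u₁, HasDerivWithinAt f (f' s) (Ici s) s)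
    (hle : ∀ s ∈ Ico u₀ u₁, -D * f s + k ≤ f' s) {s : ℝ} (hs : s ∈ Icc u₀ u₁) :
    (f u₀ + k * (s - u₀)) * Real.exp (-D * (s - u₀)) ≤ f s := by
  have hexp : ∀ s, HasDerivAt (fun s => Real.exp (D * (s - u₀)))
      (Real.exp (D * (s - u₀)) * D) s := fun s => by
    simpa using (((hasDerivAt_id s).sub_const u₀).const_mul D).exp
  have h := image_le_of_deriv_right_le_deriv_boundary (a := u₀) (b := u₁)
    (f := fun s => f u₀ + k * (s - u₀)) (f' := fun _ => k)
    (B := fun s => f s * Real.exp (D * (s - u₀)))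
    (B' := fun s => f' s * Real.exp (D * (s - u₀)) + f s * (Real.exp (D * (s - u₀)) * D))
    (by fun_prop)
    (fun s _ => by
      simpa using ((((hasDerivAt_id s).sub_const u₀).const_mul k).const_add (f u₀)).hasDerivWithinAt)
    (by simp) (hf.mul (by fun_prop))
    (fun s hs => (hf' s hs).mul (hexp s).hasDerivWithinAt)
    (fun s hs => by
      have h1 := hle s hs
      have h2 : 1 ≤ Real.exp (D * (s - u₀)) :=
        Real.one_le_exp (mul_nonneg hD (by linarith [hs.1]))
      nlinarith) hs
  have e : f s = f s * Real.exp (D * (s - u₀)) * Real.exp (-D * (s - u₀)) := by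
    rw [mul_assoc, ← Real.exp_add]
    simp
  rw [e]
  gcongr

variable {D : ℝ}

lemma IsSupersolution.le_of_weight_bound (hy : IsSupersolution b y s₀ s₁)
    (hb : ∀ s ∈ Ico s₀ s₁, ∀ i j, 0 ≤ b s i j) (hbD : ∀ s ∈ Ico s₀ s₁, ∀ i, ∑ j, b s i j ≤ D)
    (h0 : ∀ i, 0 ≤ y i s₀) (hD : 0 ≤ D) {u₀ u₁ k : ℝ} (hk : 0 ≤ k) (h₀ : s₀ ≤ u₀)
    (h₀₁ : u₀ ≤ u₁) (h₁ : u₁ ≤ s₁) {i : V} (hin : ∀ s ∈ Ico u₀ u₁, k ≤ ∑ j, b s i j * y j s) :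
    (y i u₀ + k * (u₁ - u₀)) * Real.exp (-D * (u₁ - u₀)) ≤ y i u₁ := by
  have hnn := hy.nonneg hb h0
  have hder : ∀ s, ∃ d, s ∈ Ico u₀ u₁ → HasDerivWithinAt (y i) d (Ici s) s ∧
      ∑ j, b s i j * (y j s - y i s) ≤ d := fun s => by
    by_cases hs : s ∈ Ico u₀ u₁
    · obtain ⟨d, hd⟩ := (hy.mono h₀ h₁).deriv i s hs
      exact ⟨d, fun _ => hd⟩
    · exact ⟨0, fun h => absurd h hs⟩
  choose f' hf' using hder
  refine le_of_neg_mul_add_le_deriv_right hD hk ((hy.mono h₀ h₁).cont i)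
    (fun s hs => (hf' s hs).1) (fun s hs => ?_) ⟨h₀₁, le_rfl⟩
  have hsI : s ∈ Ico s₀ s₁ := ⟨h₀.trans hs.1, hs.2.trans_le h₁⟩
  have h1 := (hf' s hs).2
  have h2 := hin s hs
  have h3 := mul_le_mul_of_nonneg_right (hbD s hsI i) (hnn s ⟨hsI.1, hsI.2.le⟩ i)
  simp only [mul_sub, Finset.sum_sub_distrib, ← Finset.sum_mul] at h1
  linarith

/-- A node keeps at least the fraction `e^{-D (u₁ - u₀)}` of its value. -/
lemma IsSupersolution.persist (hy : IsSupersolution b y s₀ s₁)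
    (hb : ∀ s ∈ Ico s₀ s₁, ∀ i j, 0 ≤ b s i j) (hbD : ∀ s ∈ Ico s₀ s₁, ∀ i, ∑ j, b s i j ≤ D)
    (h0 : ∀ i, 0 ≤ y i s₀) (hD : 0 ≤ D) {u₀ u₁ : ℝ} (h₀ : s₀ ≤ u₀)
    (h₀₁ : u₀ ≤ u₁) (h₁ : u₁ ≤ s₁) (i : V) :
    y i u₀ * Real.exp (-D * (u₁ - u₀)) ≤ y i u₁ := by
  have := hy.le_of_weight_bound hb hbD h0 hD le_rfl h₀ h₀₁ h₁ (i := i) fun s hs =>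
    Finset.sum_nonneg fun j _ => mul_nonneg (hb s ⟨h₀.trans hs.1, hs.2.trans_le h₁⟩ i j)
      (hy.nonneg hb h0 s ⟨h₀.trans hs.1, hs.2.le.trans h₁⟩ j)
  simpa using this

/-- While the edge from `j` to `i` has weight at least `β`, node `i` inherits a fraction of the
value of node `j`. -/
lemma IsSupersolution.transfer (hy : IsSupersolution b y s₀ s₁)
    (hb : ∀ s ∈ Ico s₀ s₁, ∀ i j, 0 ≤ b s i j) (hbD : ∀ s ∈ Ico s₀ s₁, ∀ i, ∑ j, b s i j ≤ D)
    (h0 : ∀ i, 0 ≤ y i s₀) (hD : 0 ≤ D) {u τ β : ℝ} (hτ : 0 ≤ τ) (hβ : 0 ≤ β) (h₀ : s₀ ≤ u)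
    (h₁ : u + τ ≤ s₁) {i j : V} (hij : ∀ s ∈ Ico u (u + τ), β ≤ b s i j) :
    τ * β * Real.exp (-(2 * D * τ)) * y j u ≤ y i (u + τ) := by
  have hnn := hy.nonneg hb h0
  have hju : 0 ≤ y j u := hnn u ⟨h₀, by linarith⟩ j
  have hiu : 0 ≤ y i u := hnn u ⟨h₀, by linarith⟩ i
  have := hy.le_of_weight_bound hb hbD h0 hD (k := β * (y j u * Real.exp (-D * τ)))
    (by positivity) h₀ (le_add_of_nonneg_right hτ) h₁ (i := i) fun s hs => by
      have hsI : s ∈ Ico s₀ s₁ := ⟨h₀.trans hs.1, hs.2.trans_le h₁⟩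
      have hj : y j u * Real.exp (-D * τ) ≤ y j s := by
        refine le_trans ?_ (hy.persist hb hbD h0 hD h₀ hs.1 hsI.2.le j)
        have : -D * τ ≤ -D * (s - u) := by nlinarith [hs.2]
        gcongr
      calc β * (y j u * Real.exp (-D * τ)) ≤ b s i j * y j s :=
            mul_le_mul (hij s hs) hj (by positivity) (hb s hsI i j)
        _ ≤ ∑ j, b s i j * y j s := Finset.single_le_sum (f := fun j => b s i j * y j s)
            (fun j _ => mul_nonneg (hb s hsI i j) (hnn s ⟨hsI.1, hsI.2.le⟩ j)) (Finset.mem_univ j)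
  refine le_trans ?_ this
  have e : Real.exp (-(2 * D * τ)) = Real.exp (-D * τ) * Real.exp (-D * τ) := by
    rw [← Real.exp_add]
    ring_nf
  rw [e, add_sub_cancel_left]
  have := mul_nonneg hiu (Real.exp_pos (-D * τ)).le
  linarith

variable {r : V} {h τ β : ℝ}

/-- The set of nodes whose values are bounded below gains at least one node in each time
window of length `h`, until it contains all nodes. -/
theorem IsSupersolution.exists_spread (hbe : IsCutExcited b r h τ β)
    (hb : ∀ s, 0 ≤ s → ∀ i j, 0 ≤ b s i j) (hbD : ∀ s, 0 ≤ s → ∀ i, ∑ j, b s i j ≤ D)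
    (hD : 0 ≤ D) (hτ : 0 ≤ τ) (hτh : τ ≤ h) (hβ : 0 ≤ β) (hs₀ : 0 ≤ s₀) {θ : ℝ} (hθ : 0 ≤ θ)
    (n : ℕ) (hy : IsSupersolution b y s₀ (s₀ + n * h)) (h0 : ∀ i, 0 ≤ y i s₀) (hr : θ ≤ y r s₀) :
    ∃ P : Finset V, r ∈ P ∧ (n < P.card ∨ P = Finset.univ) ∧
      ∀ i ∈ P, (min 1 (τ * β) * Real.exp (-(4 * D * h))) ^ n * θ ≤ y i (s₀ + n * h) := by
  classical
  have hh : 0 ≤ h := hτ.trans hτh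
  set ρ := min 1 (τ * β) * Real.exp (-(4 * D * h)) with hρ
  have hm0 : 0 ≤ min 1 (τ * β) := le_min zero_le_one (mul_nonneg hτ hβ)
  have hρ0 : 0 ≤ ρ := mul_nonneg hm0 (Real.exp_pos _).le
  induction n with
  | zero => exact ⟨{r}, by simp, by simp, by simpa using hr⟩
  | succ n ih =>
    have hn : s₀ + ((n + 1 : ℕ) : ℝ) * h = s₀ + n * h + h := by push_cast; ring
    rw [hn] at hy ⊢
    set s := s₀ + n * h with hs
    have hs0 : s₀ ≤ s := le_add_of_nonneg_right (by positivity)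
    obtain ⟨P, hrP, hcard, hP⟩ := ih (hy.mono le_rfl (by linarith))
    have hb' : ∀ u ∈ Ico s (s + h), ∀ i j, 0 ≤ b u i j := fun u hu =>
      hb u (by linarith [hu.1])
    have hbD' : ∀ u ∈ Ico s (s + h), ∀ i, ∑ j, b u i j ≤ D := fun u hu =>
      hbD u (by linarith [hu.1])
    have h0' : ∀ i, 0 ≤ y i s :=
      hy.nonneg (fun u hu => hb u (by linarith [hu.1])) h0 s ⟨hs0, by linarith⟩
    replace hy := hy.mono hs0 le_rfl
    have hθn : 0 ≤ ρ ^ n * θ := by positivity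
    have hkeep : ∀ i ∈ P, ρ ^ (n + 1) * θ ≤ y i (s + h) := fun i hi => by
      refine le_trans ?_ (hy.persist hb' hbD' h0' hD le_rfl (by linarith) le_rfl i)
      have h1 : ρ ≤ Real.exp (-D * (s + h - s)) := by
        calc ρ ≤ 1 * Real.exp (-(4 * D * h)) := by
              rw [hρ]; gcongr; exact min_le_left _ _
          _ ≤ Real.exp (-D * (s + h - s)) := by
              rw [one_mul]; gcongr; nlinarith [mul_nonneg hD hh]
      calc ρ ^ (n + 1) * θ = (ρ ^ n * θ) * ρ := by ring
        _ ≤ _ := mul_le_mul (hP i hi) h1 hρ0 (h0' i)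
    by_cases hPu : P = Finset.univ
    · exact ⟨P, hrP, Or.inr hPu, hkeep⟩
    obtain ⟨i, hiP, j, hjP, u, hsu, huh, hij⟩ := hbe s (hs₀.trans hs0) P hrP hPu
    refine ⟨insert i P, Finset.mem_insert_of_mem hrP, Or.inl ?_, fun k hk => ?_⟩
    · rw [Finset.card_insert_of_notMem hiP]
      have := hcard.resolve_right hPu
      omega
    rcases Finset.mem_insert.1 hk with rfl | hk
    · have h1 := hy.persist hb' hbD' h0' hD le_rfl hsu (by linarith) j
      have h2 := hy.transfer hb' hbD' h0' hD hτ hβ hsu huh hij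
      have h3 := hy.persist hb' hbD' h0' hD (hsu.trans (le_add_of_nonneg_right hτ)) huh le_rfl k
      have e1 : Real.exp (-(D * h)) ≤ Real.exp (-D * (u - s)) := by
        gcongr; nlinarith
      have e2 : Real.exp (-(2 * D * h)) ≤ Real.exp (-(2 * D * τ)) := by
        gcongr
      have e3 : Real.exp (-(D * h)) ≤ Real.exp (-D * (s + h - (u + τ))) := by
        gcongr; nlinarith
      have e : Real.exp (-(4 * D * h))
          = Real.exp (-(D * h)) * Real.exp (-(2 * D * h)) * Real.exp (-(D * h)) := by
        rw [← Real.exp_add, ← Real.exp_add]; ring_nf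
      have hju := h0' j
      calc ρ ^ (n + 1) * θ = min 1 (τ * β) * Real.exp (-(2 * D * h)) *
            ((ρ ^ n * θ) * Real.exp (-(D * h))) * Real.exp (-(D * h)) := by
              rw [pow_succ, hρ, e]; ring
        _ ≤ τ * β * Real.exp (-(2 * D * τ)) * (y j s * Real.exp (-D * (u - s)))
              * Real.exp (-D * (s + h - (u + τ))) := by
            gcongr
            · exact min_le_right _ _
            · exact hP j hjP
        _ ≤ τ * β * Real.exp (-(2 * D * τ)) * y j u * Real.exp (-D * (s + h - (u + τ))) := by
            gcongr
        _ ≤ y k (u + τ) * Real.exp (-D * (s + h - (u + τ))) := by gcongr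
        _ ≤ _ := h3
    · exact hkeep k hk

/-- Exponential lower bound for supersolutions of an excited consensus system whose root `r` has
no incoming edges and a nonnegative value. -/
theorem IsCutExcited.exists_exp_bound (hbe : IsCutExcited b r h τ β)
    (hb : ∀ s, 0 ≤ s → ∀ i j, 0 ≤ b s i j) (hbD : ∀ s, 0 ≤ s → ∀ i, ∑ j, b s i j ≤ D)
    (hbr : ∀ s j, b s r j = 0) (hD : 0 ≤ D) (hτ : 0 < τ) (hτh : τ ≤ h) (hβ : 0 < β) :
    ∃ c rate : ℝ, 0 < c ∧ 0 < rate ∧ ∀ (y : V → ℝ → ℝ) (s₀ s₁ M : ℝ), 0 ≤ s₀ → s₀ ≤ s₁ → 0 ≤ M →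
      IsSupersolution b y s₀ s₁ → (∀ i, -M ≤ y i s₀) → 0 ≤ y r s₀ →
      ∀ i, -(c * Real.exp (-rate * (s₁ - s₀)) * M) ≤ y i s₁ := by
  have hh : 0 < h := hτ.trans_le hτh
  set ρ := min 1 (τ * β) * Real.exp (-(4 * D * h)) with hρ
  have hm0 : 0 < min 1 (τ * β) := lt_min zero_lt_one (mul_pos hτ hβ)
  have hρ0 : 0 < ρ := mul_pos hm0 (Real.exp_pos _)
  have hρ1 : ρ ≤ 1 := mul_le_one₀ (min_le_left _ _) (Real.exp_pos _).le
    (Real.exp_le_one_iff.2 (by have := mul_nonneg hD hh.le; linarith))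
  have hV : 0 < Fintype.card V := Fintype.card_pos_iff.2 ⟨r⟩
  set n := Fintype.card V with hn
  -- After `n` windows the slack above the lower bound `-M` has reached every node.
  have step : ∀ (y : V → ℝ → ℝ) (s₀ M : ℝ), 0 ≤ s₀ → 0 ≤ M →
      IsSupersolution b y s₀ (s₀ + n * h) → (∀ i, -M ≤ y i s₀) → 0 ≤ y r s₀ →
      ∀ i, -((1 - ρ ^ n) * M) ≤ y i (s₀ + n * h) := by
    intro y s₀ M hs₀ hM hy h0 hr i
    obtain ⟨P, -, hPc, hP⟩ := IsSupersolution.exists_spread hbe hb hbD hD hτ.le hτh hβ.le hs₀ hM n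
      (hy.add_const M) (fun i => by linarith [h0 i]) (by linarith)
    have hPu : P = Finset.univ := hPc.resolve_left (by
      have := Finset.card_le_univ P
      omega)
    have := hP i (hPu ▸ Finset.mem_univ i)
    rw [← hρ] at this
    linarith
  have hroot : ∀ (y : V → ℝ → ℝ) (s₀ s₁ : ℝ), s₀ ≤ s₁ → IsSupersolution b y s₀ s₁ →
      0 ≤ y r s₀ → 0 ≤ y r s₁ := by
    intro y s₀ s₁ hs hy hr
    have hy' : IsSupersolution (fun _ _ _ => (0 : ℝ)) (fun _ : Unit => y r) s₀ s₁ :=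
      ⟨fun _ => hy.cont r, fun _ s hs => by
        obtain ⟨d, hd, hle⟩ := hy.deriv r s hs
        exact ⟨d, hd, by simpa [hbr] using hle⟩⟩
    exact hy'.nonneg (by simp) (fun _ => hr) s₁ ⟨hs, le_rfl⟩ ()
  set q := 1 - ρ ^ n with hq
  have hρn : ρ ^ n ≤ 1 := pow_le_one₀ hρ0.le hρ1
  have hq0 : 0 ≤ q := by linarith
  have hq1 : q < 1 := by have := pow_pos hρ0 n; linarith
  set T := n * h with hT
  have hT0 : 0 < T := by positivity
  have iter : ∀ (y : V → ℝ → ℝ) (s₀ M : ℝ) (k : ℕ), 0 ≤ s₀ → 0 ≤ M →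
      IsSupersolution b y s₀ (s₀ + k * T) → (∀ i, -M ≤ y i s₀) → 0 ≤ y r s₀ →
      ∀ i, -(q ^ k * M) ≤ y i (s₀ + k * T) := by
    intro y s₀ M k hs₀ hM
    induction k with
    | zero => intro _ h0 _ i; simpa using h0 i
    | succ k ih =>
      intro hy h0 hr i
      have hk : s₀ + ((k + 1 : ℕ) : ℝ) * T = s₀ + k * T + T := by push_cast; ring
      rw [hk] at hy ⊢
      have hkT : 0 ≤ k * T := by positivity
      have hyk := hy.mono le_rfl (by linarith : s₀ + k * T ≤ s₀ + k * T + T)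
      have := step y (s₀ + k * T) (q ^ k * M) (by linarith) (by positivity)
        (hy.mono (by linarith) le_rfl) (ih hyk h0 hr)
        (hroot y s₀ _ (by linarith) hyk hr) i
      rwa [pow_succ, mul_comm (q ^ k) q, mul_assoc]
  -- A positive base dominating `q` gives a positive rate.
  set p := max q (1 / 2) with hp
  have hp0 : 0 < p := lt_max_of_lt_right (by norm_num)
  have hp1 : p < 1 := max_lt hq1 (by norm_num)
  have hlog : Real.log p < 0 := Real.log_neg hp0 hp1
  refine ⟨p⁻¹, -Real.log p / T, by positivity, div_pos (by linarith) hT0, ?_⟩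
  intro y s₀ s₁ M hs₀ hs hM hy h0 hr i
  set k := ⌊(s₁ - s₀) / T⌋₊ with hk
  have hk1 : k * T ≤ s₁ - s₀ := by
    rw [← le_div_iff₀ hT0]; exact Nat.floor_le (div_nonneg (by linarith) hT0.le)
  have hk2 : (s₁ - s₀) / T - 1 ≤ k := (Nat.sub_one_lt_floor _).le
  have hyk := hy.mono le_rfl (by linarith : s₀ + k * T ≤ s₁)
  have h1 := iter y s₀ M k hs₀ hM hyk h0 hr
  have hkT : 0 ≤ k * T := by positivity
  have h2 := ((hy.mono (by linarith) le_rfl : IsSupersolution b y (s₀ + k * T) s₁).add_const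
    (q ^ k * M)).nonneg (fun s hs => hb s (by linarith [hs.1])) (fun i => by linarith [h1 i])
    s₁ ⟨by linarith, le_rfl⟩ i
  have h3 : q ^ k ≤ p⁻¹ * Real.exp (-(-Real.log p / T) * (s₁ - s₀)) := by
    calc q ^ k ≤ p ^ k := pow_le_pow_left₀ hq0 (le_max_left _ _) k
      _ = Real.exp (Real.log p * k) := by
        rw [← Real.rpow_natCast, Real.rpow_def_of_pos hp0]
      _ ≤ Real.exp (Real.log p * ((s₁ - s₀) / T - 1)) :=
        Real.exp_le_exp.2 (mul_le_mul_of_nonpos_left hk2 hlog.le)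
      _ = Real.exp (-Real.log p) * Real.exp (-(-Real.log p / T) * (s₁ - s₀)) := by
        rw [← Real.exp_add]; congr 1; ring
      _ = _ := by rw [Real.exp_neg, Real.exp_log hp0]
  have := mul_le_mul_of_nonneg_right h3 hM
  linarith

end Supersolution

/-! ### Joint connectivity and excitation of cuts -/

/-- A path that leaves a set uses an edge that leaves it. -/
lemma Relation.TransGen.exists_rel_notMem {V : Type*} {R : V → V → Prop} {a b : V}
    (h : Relation.TransGen R a b) {P : Set V} (ha : a ∈ P) (hb : b ∉ P) :
    ∃ j ∈ P, ∃ i ∉ P, R j i := by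
  induction h with
  | single hab => exact ⟨a, ha, _, hb, hab⟩
  | @tail c d _ hcd ih =>
    by_cases hc : c ∈ P
    · exact ⟨c, hc, d, hb, hcd⟩
    · exact ih hc

/-- The positive values of a function on a finite type have a positive lower bound. -/
lemma exists_pos_le_of_pos {α : Type*} [Finite α] (f : α → ℝ) :
    ∃ β : ℝ, 0 < β ∧ ∀ x, 0 < f x → β ≤ f x := by
  rcases ({x | 0 < f x} : Set α).eq_empty_or_nonempty with h | h
  · exact ⟨1, one_pos, fun x hx => absurd (show x ∈ ({x | 0 < f x} : Set α) from hx) (h ▸ id)⟩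
  · obtain ⟨x, hx, hle⟩ := Set.exists_min_image _ f (Set.toFinite _) h
    exact ⟨f x, hx, fun y hy => hle y hy⟩

/-- The weights of the observer network scaled by the gain `μ`; the leader's row is set to zero
because the leader receives no information. -/
def followerWeights {N : ℕ} (a : ℝ → Matrix (Fin (N + 1)) (Fin (N + 1)) ℝ) (μ : ℝ) (s : ℝ) :
    Fin (N + 1) → Fin (N + 1) → ℝ :=
  Fin.cons 0 fun i j => μ * a s i.succ j

section Switching

variable {P : Type*} {σ : ℝ → P} {t : ℕ → ℝ}

lemma IsSwitchingSignal.monotone (hσ : IsSwitchingSignal σ t) : Monotone t := by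
  obtain ⟨τ₀, hτ₀, hd⟩ := hσ.dwell
  exact monotone_nat_of_le_succ fun i => by linarith [hd i]

lemma IsSwitchingSignal.exists_ge (hσ : IsSwitchingSignal σ t) (s : ℝ) : ∃ k, s ≤ t k := by
  obtain ⟨τ₀, hτ₀, hd⟩ := hσ.dwell
  have h : ∀ k : ℕ, k * τ₀ ≤ t k := fun k => by
    induction k with
    | zero => simp [hσ.start]
    | succ k ih => push_cast; linarith [hd k]
  obtain ⟨k, hk⟩ := exists_nat_ge (s / τ₀)
  exact ⟨k, ((div_le_iff₀ hτ₀).1 hk).trans (h k)⟩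

theorem IsJointlyConnected.isCutExcited {N : ℕ} [Finite P] {G : P → Digraph (Fin (N + 1))}
    {A : P → Matrix (Fin (N + 1)) (Fin (N + 1)) ℝ} (hA : ∀ p, IsWeightedAdjacency (G p) (A p))
    (hσ : IsSwitchingSignal σ t) (hG : IsJointlyConnected G σ t) {μ : ℝ} (hμ : 0 < μ) :
    ∃ h τ β : ℝ, 0 < τ ∧ τ ≤ h ∧ 0 < β ∧
      IsCutExcited (followerWeights (fun s => A (σ s)) μ) 0 h τ β := by
  obtain ⟨τ₀, hτ₀, hd⟩ := hσ.dwell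
  obtain ⟨ι, hι, ⟨ε, hε, hgap⟩, hconn⟩ := hG
  obtain ⟨β, hβ, hAβ⟩ := exists_pos_le_of_pos
    fun x : P × Fin (N + 1) × Fin (N + 1) => A x.1 x.2.1 x.2.2
  have htm := hσ.monotone
  have ht0 : 0 ≤ t (ι 0) := hσ.start ▸ htm (Nat.zero_le _)
  have hτε : τ₀ ≤ ε := by
    have h1 := hgap 0
    have h2 := hd (ι 0)
    have h3 := htm (Nat.succ_le_of_lt (hι (Nat.lt_succ_self 0)))
    simp only [Nat.succ_eq_add_one] at h3
    linarith
  refine ⟨t (ι 0) + 2 * ε, τ₀, μ * β, hτ₀, by linarith, by positivity, ?_⟩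
  intro s₀ hs₀ Q h0 hQ
  -- The first window start after `s₀` comes within time `t (ι 0) + ε`.
  have hex : ∃ k, s₀ ≤ t (ι k) := by
    obtain ⟨k, hk⟩ := hσ.exists_ge s₀
    exact ⟨k, hk.trans (htm (hι.id_le k))⟩
  obtain ⟨k, hk1, hk2⟩ : ∃ k, s₀ ≤ t (ι k) ∧ t (ι k) ≤ s₀ + (t (ι 0) + ε) := by
    classical
    refine ⟨Nat.find hex, Nat.find_spec hex, ?_⟩
    rcases hk : Nat.find hex with _ | k
    · linarith
    · have h1 := not_le.1 (Nat.find_min hex (show k < Nat.find hex by omega))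
      have h2 := hgap k
      linarith
  obtain ⟨i, hiQ⟩ : ∃ i, i ∉ Q := by
    by_contra! hall
    exact hQ (Finset.eq_univ_iff_forall.2 hall)
  obtain ⟨j, hj, i, hi, hji⟩ := (hconn k i (fun e => hiQ (e ▸ h0))).exists_rel_notMem
    (P := (Q : Set _)) (Finset.mem_coe.2 h0) (fun h => hiQ (Finset.mem_coe.1 h))
  simp only [Digraph.iSup_adj] at hji
  obtain ⟨l, hl, hadj⟩ := hji
  rw [Finset.mem_Ico] at hl
  refine ⟨i, hi, j, hj, t l, hk1.trans (htm hl.1), ?_, fun s hs => ?_⟩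
  · have h1 := hd l
    have h2 := htm (Nat.succ_le_of_lt hl.2)
    have h3 := hgap k
    simp only [Nat.succ_eq_add_one] at h2
    linarith
  · have hi0 : i ≠ 0 := fun e => hi (e ▸ h0)
    obtain ⟨i, rfl⟩ := Fin.exists_succ_eq.2 hi0
    have hs' : σ s = σ (t l) := hσ.const l s ⟨hs.1, by linarith [hs.2, hd l]⟩
    simp only [followerWeights, Fin.cons_succ, hs']
    exact mul_le_mul_of_nonneg_left
      (hAβ (σ (t l), i.succ, j) (((hA _).pos_iff _ _).2 hadj)) hμ.le

end Switching

/-! ### Growth of the solutions of a linear system without unstable eigenvalues -/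

lemma HasDerivAt.comp_ofReal_of_vector {W : Type*} [NormedAddCommGroup W] [NormedSpace ℂ W]
    {f : ℂ → W} {f' : W} {s : ℝ}
    (h : HasDerivAt f f' (s : ℂ)) : HasDerivAt (fun s : ℝ => f s) f' s := by
  simpa [Function.comp_def] using h.scomp s Complex.ofRealCLM.hasDerivAt

section ComplexGrowth

variable {W : Type*} [NormedAddCommGroup W] [NormedSpace ℂ W] [CompleteSpace W]

lemma hasDerivAt_exp_smul_apply (T : W →L[ℂ] W) (w : W) (z : ℂ) :
    HasDerivAt (fun z : ℂ => NormedSpace.exp (z • T) w) (NormedSpace.exp (z • T) (T w)) z := by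
  simpa using (hasDerivAt_exp_smul_const T z).clm_apply (hasDerivAt_const z w)

/-- Along a generalized eigenvector of rank at most `k`, the exponential is `e^{μ t}` times a
factor of at most polynomial growth. -/
lemma exists_norm_exp_smul_apply_le (T : W →L[ℂ] W) (μ : ℂ) (k : ℕ) :
    ∀ w, ((T - μ • (1 : W →L[ℂ] W)) ^ k) w = 0 → ∃ C : ℝ, 0 ≤ C ∧ ∀ t : ℝ, 0 ≤ t →
      ‖Complex.exp (-μ * t) • NormedSpace.exp ((t : ℂ) • T) w‖ ≤ C * (1 + t) ^ k := by
  induction k with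
  | zero =>
    intro w hw
    have hw : w = 0 := by simpa using hw
    exact ⟨0, le_rfl, fun t _ => by simp [hw]⟩
  | succ k ih =>
    intro w hw
    obtain ⟨C, hC, hbd⟩ := ih ((T - μ • (1 : W →L[ℂ] W)) w) (by
      rw [pow_succ] at hw
      exact hw)
    refine ⟨‖w‖ + C, by positivity, fun t ht => ?_⟩
    set g : ℝ → W := fun t => Complex.exp (-μ * t) • NormedSpace.exp ((t : ℂ) • T) w with hg
    have hder : ∀ s : ℝ, HasDerivAt g (Complex.exp (-μ * s) • NormedSpace.exp ((s : ℂ) • T)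
        ((T - μ • (1 : W →L[ℂ] W)) w)) s := fun s => by
      have h1 : HasDerivAt (fun z : ℂ => Complex.exp (-μ * z)) (Complex.exp (-μ * s) * -μ) s := by
        simpa using ((hasDerivAt_id (s : ℂ)).const_mul (-μ)).cexp
      have hw' : (T - μ • (1 : W →L[ℂ] W)) w = T w - μ • w := rfl
      refine (h1.smul (hasDerivAt_exp_smul_apply T w s)).comp_ofReal_of_vector.congr_deriv ?_
      rw [hw', map_sub, map_smul, smul_sub, smul_smul, mul_neg, neg_smul, sub_eq_add_neg]
    have hgt := norm_image_sub_le_of_norm_deriv_right_le_segment (f := g) (a := 0) (b := t)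
      (C := C * (1 + t) ^ k)
      (fun s _ => (hder s).continuousAt.continuousWithinAt)
      (fun s _ => (hder s).hasDerivWithinAt)
      (fun s hs => (hbd s hs.1).trans (by have := hs.1; have := hs.2; gcongr))
      t ⟨ht, le_rfl⟩
    have h0 : g 0 = w := by simp [hg]
    have h1 : ‖g t‖ ≤ ‖g t - g 0‖ + ‖w‖ := by
      calc ‖g t‖ = ‖(g t - g 0) + w‖ := by rw [h0, sub_add_cancel]
        _ ≤ _ := norm_add_le _ _
    have h2 : 1 ≤ (1 + t) ^ (k + 1) := one_le_pow₀ (by linarith)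
    have h3 : C * (1 + t) ^ k * (t - 0) ≤ C * (1 + t) ^ (k + 1) := by
      rw [pow_succ, ← mul_assoc]
      exact mul_le_mul_of_nonneg_left (by linarith) (by positivity)
    have h4 := mul_le_mul_of_nonneg_left h2 (norm_nonneg w)
    change ‖g t‖ ≤ _
    linarith

/-- If no eigenvalue has positive real part, then the exponential grows at most polynomially along
every vector, because the generalized eigenspaces span. -/
lemma exists_norm_exp_smul_apply_le_pow [FiniteDimensional ℂ W] (T : W →L[ℂ] W)
    (hT : ∀ z : ℂ, Module.End.HasEigenvalue (T : W →ₗ[ℂ] W) z → z.re ≤ 0) (w : W) :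
    ∃ C : ℝ, ∃ k : ℕ, 0 ≤ C ∧ ∀ t : ℝ, 0 ≤ t →
      ‖NormedSpace.exp ((t : ℂ) • T) w‖ ≤ C * (1 + t) ^ k := by
  let p : Submodule ℂ W :=
    { carrier := {w | ∃ C : ℝ, ∃ k : ℕ, 0 ≤ C ∧ ∀ t : ℝ, 0 ≤ t →
        ‖NormedSpace.exp ((t : ℂ) • T) w‖ ≤ C * (1 + t) ^ k}
      zero_mem' := ⟨0, 0, le_rfl, by simp⟩
      add_mem' := by
        rintro x y ⟨C, k, hC, hx⟩ ⟨C', k', hC', hy⟩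
        refine ⟨C + C', max k k', by positivity, fun t ht => ?_⟩
        have h1 : (1 + t) ^ k ≤ (1 + t) ^ max k k' :=
          pow_le_pow_right₀ (by linarith) (le_max_left _ _)
        have h2 : (1 + t) ^ k' ≤ (1 + t) ^ max k k' :=
          pow_le_pow_right₀ (by linarith) (le_max_right _ _)
        rw [map_add, add_mul]
        exact (norm_add_le _ _).trans (add_le_add
          ((hx t ht).trans (mul_le_mul_of_nonneg_left h1 hC))
          ((hy t ht).trans (mul_le_mul_of_nonneg_left h2 hC')))
      smul_mem' := by
        rintro z x ⟨C, k, hC, hx⟩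
        refine ⟨‖z‖ * C, k, by positivity, fun t ht => ?_⟩
        rw [map_smul, norm_smul, mul_assoc]
        exact mul_le_mul_of_nonneg_left (hx t ht) (norm_nonneg _) }
  suffices h : (⊤ : Submodule ℂ W) ≤ p from h (Submodule.mem_top (x := w))
  rw [← Module.End.iSup_maxGenEigenspace_eq_top (T : W →ₗ[ℂ] W), iSup_le_iff]
  intro μ x hx
  by_cases hx0 : x = 0
  · rw [hx0]; exact p.zero_mem
  obtain ⟨k, hk⟩ := (Module.End.mem_maxGenEigenspace _ _ _).1 hx
  have hμ : μ.re ≤ 0 := by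
    refine hT μ (Module.End.hasEigenvalue_of_hasGenEigenvalue (k := k) ?_)
    refine fun hbot => hx0 ?_
    rw [← Submodule.mem_bot ℂ, ← hbot]
    exact Module.End.mem_genEigenspace_nat.2 hk
  have hk' : ((T - μ • (1 : W →L[ℂ] W)) ^ k) x = 0 := by
    rw [← hk]
    have : ((T : W →ₗ[ℂ] W) - μ • 1) = ((T - μ • (1 : W →L[ℂ] W) : W →L[ℂ] W) : W →ₗ[ℂ] W) := by
      ext; simp
    rw [this, ← ContinuousLinearMap.toLinearMap_pow]
    rfl
  obtain ⟨C, hC, hbd⟩ := exists_norm_exp_smul_apply_le T μ k x hk'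
  refine ⟨C, k, hC, fun t ht => le_trans ?_ (hbd t ht)⟩
  rw [norm_smul, Complex.norm_exp]
  refine le_mul_of_one_le_left (norm_nonneg _) (Real.one_le_exp ?_)
  simpa using mul_nonneg (neg_nonneg.2 hμ) ht

lemma exists_norm_exp_smul_le_exp [FiniteDimensional ℂ W] (T : W →L[ℂ] W)
    (hT : ∀ z : ℂ, Module.End.HasEigenvalue (T : W →ₗ[ℂ] W) z → z.re ≤ 0) {δ : ℝ} (hδ : 0 < δ) :
    ∃ C : ℝ, 0 < C ∧ ∀ t : ℝ, 0 ≤ t → ∀ w,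
      ‖NormedSpace.exp ((t : ℂ) • T) w‖ ≤ C * Real.exp (δ * t) * ‖w‖ := by
  have hexp : ∀ w, ∃ C : ℝ, 0 ≤ C ∧ ∀ t : ℝ, 0 ≤ t →
      ‖NormedSpace.exp ((t : ℂ) • T) w‖ ≤ C * Real.exp (δ * t) := fun w => by
    obtain ⟨C, k, hC, hbd⟩ := exists_norm_exp_smul_apply_le_pow T hT w
    refine ⟨C * (k.factorial / δ ^ k * Real.exp δ), by positivity, fun t ht => ?_⟩
    refine (hbd t ht).trans ?_
    have h := Real.pow_div_factorial_le_exp (δ * (1 + t)) (by positivity) k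
    rw [div_le_iff₀ (by positivity), mul_pow] at h
    have e : Real.exp (δ * (1 + t)) = Real.exp δ * Real.exp (δ * t) := by
      rw [← Real.exp_add]; ring_nf
    rw [e] at h
    rw [mul_assoc]
    refine mul_le_mul_of_nonneg_left ?_ hC
    have : (1 + t) ^ k ≤ (Real.exp δ * Real.exp (δ * t) * k.factorial) / δ ^ k := by
      rw [le_div_iff₀ (by positivity)]
      linarith
    refine this.trans (le_of_eq ?_)
    ring
  choose C hC hbd using hexp
  let b := Module.finBasis ℂ W
  -- Expand in a basis; the coordinates are bounded linear functionals.
  let B := fun i => ‖LinearMap.toContinuousLinearMap (b.coord i)‖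
  refine ⟨∑ i, B i * C (b i) + 1, by
    have : 0 ≤ ∑ i, B i * C (b i) :=
      Finset.sum_nonneg fun i _ => mul_nonneg (norm_nonneg _) (hC _)
    linarith, fun t ht w => ?_⟩
  calc ‖NormedSpace.exp ((t : ℂ) • T) w‖
      = ‖∑ i, b.repr w i • NormedSpace.exp ((t : ℂ) • T) (b i)‖ := by
        conv_lhs => rw [← b.sum_repr w]
        simp only [map_sum, map_smul]
    _ ≤ ∑ i, ‖b.repr w i • NormedSpace.exp ((t : ℂ) • T) (b i)‖ := norm_sum_le _ _
    _ ≤ ∑ i, (B i * ‖w‖) * (C (b i) * Real.exp (δ * t)) := by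
        refine Finset.sum_le_sum fun i _ => ?_
        rw [norm_smul]
        exact mul_le_mul ((LinearMap.toContinuousLinearMap (b.coord i)).le_opNorm w) (hbd _ t ht)
          (norm_nonneg _) (mul_nonneg (norm_nonneg _) (norm_nonneg _))
    _ = (∑ i, B i * C (b i)) * Real.exp (δ * t) * ‖w‖ := by
        rw [Finset.sum_mul, Finset.sum_mul]
        exact Finset.sum_congr rfl fun i _ => by ring
    _ ≤ _ := by
        gcongr
        linarith

end ComplexGrowth

/-- Solutions of `v' = S v` grow at most like `e^{δ t}`, for every `δ > 0`. -/
theorem NoEigenvalueWithPosRe.exists_norm_solution_le {m : ℕ} {S : Matrix (Fin m) (Fin m) ℝ}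
    (hS : NoEigenvalueWithPosRe S) {δ : ℝ} (hδ : 0 < δ) :
    ∃ C : ℝ, 0 < C ∧ ∀ v : ℝ → Fin m → ℝ, IsSolution (fun _ x => S *ᵥ x) v → ∀ t, 0 ≤ t →
      ‖v t‖ ≤ C * Real.exp (δ * t) * ‖v 0‖ := by
  set T : (Fin m → ℂ) →L[ℂ] (Fin m → ℂ) :=
    LinearMap.toContinuousLinearMap (Matrix.toLin' (S.map (algebraMap ℝ ℂ))) with hT
  obtain ⟨C, hC, hbd⟩ := exists_norm_exp_smul_le_exp T (fun z hz => hS z hz) hδ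
  refine ⟨C, hC, fun v hv t ht => ?_⟩
  -- Compare the complexified solution with the matrix exponential.
  set u : ℝ → Fin m → ℂ := fun s i => (v s i : ℂ) with hu
  have hnorm : ∀ s, ‖u s‖ = ‖v s‖ := fun s => by
    simp [hu, Pi.norm_def]
  have hTu : ∀ s, T (u s) = fun i => ((S *ᵥ v s) i : ℂ) := fun s => by
    ext i
    simp [hT, hu, Matrix.mulVec, dotProduct]
  have hud : ∀ s, 0 ≤ s → HasDerivWithinAt u (T (u s)) (Ici s) s := fun s hs => by
    rw [hTu]
    exact hasDerivWithinAt_pi.2 fun i =>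
      (hasDerivWithinAt_pi.1 (hv.2 s hs) i).ofReal_comp
  have huc : ContinuousOn u (Icc 0 t) := continuousOn_pi.2 fun i =>
    Complex.continuous_ofReal.comp_continuousOn
      ((continuousOn_pi.1 hv.1 i).mono Icc_subset_Ici_self)
  have hexp : ∀ s : ℝ, HasDerivAt (fun s : ℝ => NormedSpace.exp ((s : ℂ) • T) (u 0))
      (T (NormedSpace.exp ((s : ℂ) • T) (u 0))) s := fun s => by
    have := ((hasDerivAt_exp_smul_const' T (s : ℂ)).clm_apply
      (hasDerivAt_const (s : ℂ) (u 0))).comp_ofReal_of_vector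
    rw [map_zero, add_zero] at this
    exact this
  have huniq := ODE_solution_unique_of_mem_Icc_right (v := fun _ x => T x) (s := fun _ => univ)
    (K := ‖T‖₊) (a := 0) (b := t) (fun _ _ => T.lipschitz.lipschitzOnWith) huc
    (fun s hs => hud s hs.1) (fun _ _ => mem_univ _)
    (fun s _ => (hexp s).continuousAt.continuousWithinAt)
    (fun s _ => (hexp s).hasDerivWithinAt) (fun _ _ => mem_univ _)
    (by
      have h0 : ((0 : ℝ) : ℂ) • T = 0 := by ext; simp
      simp only [h0, NormedSpace.exp_zero]
      rfl)
  rw [← hnorm, ← hnorm 0, huniq ⟨ht, le_rfl⟩]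
  exact hbd t ht _

/-! ### Perturbed consensus with a leader at zero -/

lemma exists_row_sum_le {P V : Type*} [Finite P] [Fintype V] (A : P → Matrix V V ℝ) :
    ∃ D : ℝ, 0 ≤ D ∧ ∀ p i, ∑ j, A p i j ≤ D := by
  cases nonempty_fintype P
  refine ⟨∑ x : P × V, |∑ j, A x.1 x.2 j|, Finset.sum_nonneg fun _ _ => abs_nonneg _,
    fun p i => (le_abs_self _).trans ?_⟩
  exact Finset.single_le_sum (f := fun x : P × V => |∑ j, A x.1 x.2 j|)
    (fun _ _ => abs_nonneg _) (Finset.mem_univ (p, i))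

section Consensus

variable {N : ℕ} {a : ℝ → Matrix (Fin (N + 1)) (Fin (N + 1)) ℝ} {μ : ℝ}

/-- Adding `γ (s - s₀)` to the states of the followers compensates a disturbance of size at most
`γ` and makes the consensus dynamics a supersolution. -/
lemma isSupersolution_of_disturbance (ha : ∀ s i j, 0 ≤ a s i j) (hμ : 0 ≤ μ) {γ s₀ s₁ : ℝ}
    (hγ : 0 ≤ γ) {x g : Fin N → ℝ → ℝ} (hx : ∀ i, ContinuousOn (x i) (Icc s₀ s₁))
    (hx' : ∀ i, ∀ s ∈ Ico s₀ s₁, HasDerivWithinAt (x i) (μ * ∑ j : Fin (N + 1), a s i.succ j *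
      ((Fin.cons 0 fun k => x k s : Fin (N + 1) → ℝ) j - x i s) + g i s) (Ici s) s)
    (hg : ∀ i, ∀ s ∈ Ico s₀ s₁, |g i s| ≤ γ) :
    IsSupersolution (followerWeights a μ)
      (Fin.cons (fun _ => 0) fun i s => x i s + γ * (s - s₀)) s₀ s₁ where
  cont i := by
    refine Fin.cases ?_ (fun i => ?_) i
    · simpa using continuousOn_const
    · exact (hx i).add (by fun_prop)
  deriv i s hs := by
    refine Fin.cases ?_ (fun i => ?_) i
    · exact ⟨0, by simpa using hasDerivWithinAt_const s (Ici s) (0 : ℝ),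
        by simp [followerWeights]⟩
    · have hlin : HasDerivWithinAt (fun s => γ * (s - s₀)) γ (Ici s) s := by
        simpa using (((hasDerivAt_id s).sub_const s₀).const_mul γ).hasDerivWithinAt
      refine ⟨_, (hx' i s hs).add hlin, ?_⟩
      have hg' := neg_le_of_abs_le (hg i s hs)
      have hle : ∑ j, followerWeights a μ s i.succ j *
          ((Fin.cons (fun _ => 0) fun i s => x i s + γ * (s - s₀) : Fin (N + 1) → ℝ → ℝ) j s -
            (x i s + γ * (s - s₀))) ≤
          μ * ∑ j : Fin (N + 1), a s i.succ j *
            ((Fin.cons 0 fun k => x k s : Fin (N + 1) → ℝ) j - x i s) := by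
        rw [Finset.mul_sum]
        refine Finset.sum_le_sum fun j _ => ?_
        simp only [followerWeights, Fin.cons_succ, mul_assoc]
        refine mul_le_mul_of_nonneg_left (mul_le_mul_of_nonneg_left ?_ (ha _ _ _)) hμ
        refine Fin.cases ?_ (fun j => ?_) j
        · have := mul_nonneg hγ (sub_nonneg.2 hs.1)
          simp only [Fin.cons_zero]
          linarith
        · simp only [Fin.cons_succ]
          linarith
      simp only [Fin.cons_succ] at hle ⊢
      linarith

/-- The followers' states decay exponentially, up to the accumulated effect of a bounded
disturbance, with constants that do not depend on the initial time. -/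
def HasConsensusBound (a : ℝ → Matrix (Fin (N + 1)) (Fin (N + 1)) ℝ) (μ c rate : ℝ) : Prop :=
  ∀ (x g : Fin N → ℝ → ℝ) (s₀ s₁ M γ : ℝ), 0 ≤ s₀ → s₀ ≤ s₁ → 0 ≤ M → 0 ≤ γ →
    (∀ i, ContinuousOn (x i) (Icc s₀ s₁)) →
    (∀ i, ∀ s ∈ Ico s₀ s₁, HasDerivWithinAt (x i) (μ * ∑ j : Fin (N + 1), a s i.succ j *
      ((Fin.cons 0 fun k => x k s : Fin (N + 1) → ℝ) j - x i s) + g i s) (Ici s) s) →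
    (∀ i, ∀ s ∈ Ico s₀ s₁, |g i s| ≤ γ) → (∀ i, |x i s₀| ≤ M) →
    ∀ i, |x i s₁| ≤ c * Real.exp (-rate * (s₁ - s₀)) * M + γ * (s₁ - s₀)

theorem exists_hasConsensusBound {P : Type*} [Finite P] {G : P → Digraph (Fin (N + 1))}
    {A : P → Matrix (Fin (N + 1)) (Fin (N + 1)) ℝ} (hA : ∀ p, IsWeightedAdjacency (G p) (A p))
    {σ : ℝ → P} {t : ℕ → ℝ} (hσ : IsSwitchingSignal σ t) (hG : IsJointlyConnected G σ t)
    (hμ : 0 < μ) :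
    ∃ c rate : ℝ, 0 < c ∧ 0 < rate ∧ HasConsensusBound (fun s => A (σ s)) μ c rate := by
  obtain ⟨h, τ, β, hτ, hτh, hβ, hexc⟩ := hG.isCutExcited hA hσ hμ
  obtain ⟨D, hD, hAD⟩ := exists_row_sum_le A
  obtain ⟨c, rate, hc, hrate, hbd⟩ := hexc.exists_exp_bound (D := μ * D)
    (fun s _ i j => by
      refine Fin.cases ?_ (fun i => ?_) i
      · simp [followerWeights]
      · simpa [followerWeights] using mul_nonneg hμ.le ((hA (σ s)).nonneg _ _))
    (fun s _ i => by
      refine Fin.cases ?_ (fun i => ?_) i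
      · simpa [followerWeights] using mul_nonneg hμ.le hD
      · simpa [followerWeights, ← Finset.mul_sum] using
          mul_le_mul_of_nonneg_left (hAD (σ s) i.succ) hμ.le)
    (fun s j => by simp [followerWeights]) (mul_nonneg hμ.le hD) hτ hτh hβ
  refine ⟨c, rate, hc, hrate, ?_⟩
  have lower : ∀ (x g : Fin N → ℝ → ℝ) (s₀ s₁ M γ : ℝ), 0 ≤ s₀ → s₀ ≤ s₁ → 0 ≤ M → 0 ≤ γ →
      (∀ i, ContinuousOn (x i) (Icc s₀ s₁)) →
      (∀ i, ∀ s ∈ Ico s₀ s₁, HasDerivWithinAt (x i) (μ * ∑ j : Fin (N + 1), A (σ s) i.succ j *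
        ((Fin.cons 0 fun k => x k s : Fin (N + 1) → ℝ) j - x i s) + g i s) (Ici s) s) →
      (∀ i, ∀ s ∈ Ico s₀ s₁, |g i s| ≤ γ) → (∀ i, -M ≤ x i s₀) →
      ∀ i, -(c * Real.exp (-rate * (s₁ - s₀)) * M + γ * (s₁ - s₀)) ≤ x i s₁ := by
    intro x g s₀ s₁ M γ hs₀ hs hM hγ hx hx' hg h0 i
    have := hbd _ s₀ s₁ M hs₀ hs hM
      (isSupersolution_of_disturbance (a := fun s => A (σ s)) (fun s => (hA (σ s)).nonneg) hμ.le hγ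
        hx hx' hg)
      (fun i => by
        refine Fin.cases ?_ (fun i => ?_) i
        · simpa using hM
        · simpa using h0 i) (by simp) i.succ
    simp only [Fin.cons_succ] at this
    linarith
  intro x g s₀ s₁ M γ hs₀ hs hM hγ hx hx' hg h0 i
  refine abs_le.2 ⟨lower x g s₀ s₁ M γ hs₀ hs hM hγ hx hx' hg
    (fun i => neg_le_of_abs_le (h0 i)) i, ?_⟩
  -- The upper bound is the lower bound for `-x`.
  have := lower (fun i s => -x i s) (fun i s => -g i s) s₀ s₁ M γ hs₀ hs hM hγ
    (fun i => (hx i).neg)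
    (fun i s hs => by
      refine (hx' i s hs).neg.congr_deriv ?_
      rw [neg_add, ← mul_neg, ← Finset.sum_neg_distrib]
      congr 2
      refine Finset.sum_congr rfl fun j _ => ?_
      refine Fin.cases ?_ (fun j => ?_) j
      · simp only [Fin.cons_zero]; ring
      · simp only [Fin.cons_succ]; ring)
    (fun i s hs => by simpa using hg i s hs)
    (fun i => neg_le_neg (le_of_abs_le (h0 i))) i
  linarith

end Consensus

/-! ### Convergence under a vanishing perturbation -/

/-- A function that contracts over each time step of length `L`, up to a vanishing error relative
to its size, tends to zero. -/
lemma tendsto_zero_of_step_contraction {f ψ : ℝ → ℝ} {L : ℝ} (hL : 0 < L)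
    (hf : ContinuousOn f (Ici 0)) (hf0 : ∀ s, 0 ≤ f s) (hψ : Tendsto ψ atTop (𝓝 0))
    (hstep : ∀ s, 0 ≤ s → f (s + L) ≤ 1 / 4 * f s + ψ s * (f s + 1)) :
    Tendsto f atTop (𝓝 0) := by
  rw [Metric.tendsto_atTop]
  intro ε hε
  obtain ⟨S', hS'⟩ := eventually_atTop.1
    (hψ.eventually (gt_mem_nhds (show (0 : ℝ) < min (1 / 4) (ε / 4) by positivity)))
  set S := max S' 0 with hS
  have hS0 : 0 ≤ S := le_max_right _ _
  have hhalf : ∀ s, S ≤ s → f (s + L) ≤ 1 / 2 * f s + ε / 4 := fun s hs => by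
    have h1 := hS' s ((le_max_left _ _).trans hs)
    have h2 : ψ s ≤ 1 / 4 := h1.le.trans (min_le_left _ _)
    have h3 : ψ s ≤ ε / 4 := h1.le.trans (min_le_right _ _)
    have h4 := hstep s (hS0.trans hs)
    have h5 := mul_le_mul_of_nonneg_right h2 (hf0 s)
    linarith
  obtain ⟨B, hB⟩ := isCompact_Icc.exists_bound_of_continuousOn
    (hf.mono (fun s hs => hS0.trans hs.1 : Icc S (S + L) ⊆ Ici 0))
  have hB0 : 0 ≤ B := (norm_nonneg _).trans (hB S ⟨le_rfl, by linarith⟩)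
  have iter : ∀ n : ℕ, ∀ s ∈ Icc S (S + L), f (s + n * L) ≤ (1 / 2) ^ n * B + ε / 2 := by
    intro n s hs
    induction n with
    | zero =>
      have := (le_abs_self _).trans (hB s hs)
      simp only [Nat.cast_zero, zero_mul, add_zero, pow_zero, one_mul]
      linarith
    | succ n ih =>
      have h1 := hhalf (s + n * L) (hs.1.trans (le_add_of_nonneg_right (by positivity)))
      have e : s + ((n + 1 : ℕ) : ℝ) * L = s + n * L + L := by push_cast; ring
      rw [e, pow_succ]
      linarith
  obtain ⟨n₀, hn₀⟩ := exists_pow_lt_of_lt_one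
    (show 0 < ε / 2 / (B + 1) by positivity) (show (1 / 2 : ℝ) < 1 by norm_num)
  refine ⟨S + (n₀ + 1) * L, fun s hs => ?_⟩
  have hn0L : 0 ≤ (n₀ : ℝ) * L := by positivity
  set n := ⌊(s - S) / L⌋₊ with hn
  have hsS : 0 ≤ (s - S) / L := div_nonneg (by linarith) hL.le
  have h1 : n * L ≤ s - S := by
    rw [← le_div_iff₀ hL]; exact Nat.floor_le hsS
  have h2 : s - S ≤ (n + 1) * L := by
    rw [← div_le_iff₀ hL]; exact (Nat.lt_floor_add_one _).le
  have h3 : n₀ ≤ n := Nat.le_floor (by rw [le_div_iff₀ hL]; linarith)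
  have h4 := iter n (s - n * L) ⟨by linarith, by linarith⟩
  rw [sub_add_cancel] at h4
  have h5 : (1 / 2 : ℝ) ^ n * B < ε / 2 := by
    have h6 : (1 / 2 : ℝ) ^ n ≤ (1 / 2) ^ n₀ :=
      pow_le_pow_of_le_one (by norm_num) (by norm_num) h3
    have h7 := h6.trans_lt hn₀
    rw [lt_div_iff₀ (by positivity)] at h7
    have : (0 : ℝ) < (1 / 2) ^ n := by positivity
    linarith
  rw [Real.dist_eq, sub_zero, abs_of_nonneg (hf0 s)]
  linarith

section Perturbation

variable {N m : ℕ}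

/-- Factoring out the flow of `S` removes the drift term and leaves a disturbed consensus
system. -/
lemma HasDerivWithinAt.exp_neg_smul_apply {E : Type*} [NormedAddCommGroup E] [NormedSpace ℝ E]
    [CompleteSpace E] (R : E →L[ℝ] E) {x : ℝ → E} {w : E} {s₀ s : ℝ}
    (hx : HasDerivWithinAt x (R (x s) + w) (Ici s) s) :
    HasDerivWithinAt (fun s => NormedSpace.exp ((s₀ - s) • R) (x s))
      (NormedSpace.exp ((s₀ - s) • R) w) (Ici s) s := by
  have h1 : HasDerivAt (fun s => NormedSpace.exp ((s₀ - s) • R))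
      ((-1 : ℝ) • (NormedSpace.exp ((s₀ - s) • R) * R)) s :=
    (hasDerivAt_exp_smul_const R (s₀ - s)).scomp s ((hasDerivAt_id s).const_sub s₀)
  refine (h1.hasDerivWithinAt.clm_apply hx).congr_deriv ?_
  rw [map_add]
  simp

lemma norm_consensus_le {E : Type*} [NormedAddCommGroup E] [NormedSpace ℝ E]
    {a : Matrix (Fin (N + 1)) (Fin (N + 1)) ℝ} (ha : ∀ i j, 0 ≤ a i j) {D : ℝ}
    (haD : ∀ i, ∑ j, a i j ≤ D) (x : Fin N → E) (i : Fin N) :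
    ‖∑ j : Fin (N + 1), a i.succ j • ((Fin.cons 0 x : Fin (N + 1) → E) j - x i)‖ ≤
      D * (2 * ‖x‖) := by
  refine (norm_sum_le _ _).trans ?_
  calc ∑ j : Fin (N + 1), ‖a i.succ j • ((Fin.cons 0 x : Fin (N + 1) → E) j - x i)‖
      ≤ ∑ j : Fin (N + 1), a i.succ j * (2 * ‖x‖) := by
        refine Finset.sum_le_sum fun j _ => ?_
        rw [norm_smul, Real.norm_of_nonneg (ha _ _)]
        refine mul_le_mul_of_nonneg_left ((norm_sub_le _ _).trans ?_) (ha _ _)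
        have h1 : ‖(Fin.cons 0 x : Fin (N + 1) → E) j‖ ≤ ‖x‖ := by
          refine Fin.cases ?_ (fun j => ?_) j
          · simp
          · simpa using norm_le_pi_norm x j
        linarith [norm_le_pi_norm x i]
    _ ≤ D * (2 * ‖x‖) := by
        rw [← Finset.sum_mul]
        exact mul_le_mul_of_nonneg_right (haD _) (by positivity)

lemma gronwallBound_le {δ K ε x : ℝ} (hK : 0 < K) (hε : 0 ≤ ε) :
    gronwallBound δ K ε x ≤ (δ + ε / K) * Real.exp (K * x) := by
  rw [gronwallBound_of_K_ne_0 hK.ne']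
  have : 0 ≤ ε / K := by positivity
  linarith

/-- The coupled linear systems `(e i)' = S (e i) + μ ∑ j, a i j (e j - e i) + d i` with the
leader's state at zero are attracted to zero when `d` is small relative to `‖e‖ + 1`. Over a
window of fixed length `L`, the exponential decay of the consensus part outweighs the
subexponential growth of the flow of `S`. -/
theorem tendsto_zero_of_vanishing_disturbance {S : Matrix (Fin m) (Fin m) ℝ}
    (hS : NoEigenvalueWithPosRe S) {a : ℝ → Matrix (Fin (N + 1)) (Fin (N + 1)) ℝ}
    (ha : ∀ s i j, 0 ≤ a s i j) {D : ℝ} (hD : 0 ≤ D) (haD : ∀ s i, ∑ j, a s i j ≤ D)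
    {μ c rate : ℝ} (hμ : 0 ≤ μ) (hc : 0 < c) (hrate : 0 < rate)
    (hcons : HasConsensusBound a μ c rate) {Q κ : ℝ} (hQ : 0 ≤ Q) (hκ : 0 < κ)
    {e d : Fin N → ℝ → Fin m → ℝ} (hec : ∀ i, ContinuousOn (e i) (Ici 0))
    (hed : ∀ i s, 0 ≤ s → HasDerivWithinAt (e i) (S *ᵥ e i s + (d i s + μ • ∑ j : Fin (N + 1),
      a s i.succ j • ((Fin.cons 0 fun k => e k s : Fin (N + 1) → Fin m → ℝ) j - e i s)))
      (Ici s) s)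
    (hd : ∀ i s, 0 ≤ s → ‖d i s‖ ≤ Q * Real.exp (-κ * s) * (‖e i s‖ + 1)) (i : Fin N) :
    Tendsto (e i) atTop (𝓝 0) := by
  set R : (Fin m → ℝ) →L[ℝ] (Fin m → ℝ) := LinearMap.toContinuousLinearMap S.mulVecLin with hR
  have hRS : ∀ x, R x = S *ᵥ x := fun x => rfl
  obtain ⟨C, hC, hgrow⟩ := hS.exists_norm_solution_le (half_pos hrate)
  have hflow : ∀ t, 0 ≤ t → ∀ w, ‖NormedSpace.exp (t • R) w‖ ≤
      C * Real.exp (rate / 2 * t) * ‖w‖ := fun t ht w => by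
    have hder : ∀ s, HasDerivAt (fun s : ℝ => NormedSpace.exp (s • R) w)
        (S *ᵥ (NormedSpace.exp (s • R) w)) s := fun s => by
      rw [← hRS]
      simpa using (hasDerivAt_exp_smul_const' R s).clm_apply (hasDerivAt_const s w)
    simpa using hgrow (fun s => NormedSpace.exp (s • R) w)
      ⟨fun s _ => (hder s).continuousAt.continuousWithinAt,
        fun s _ => (hder s).hasDerivWithinAt⟩ t ht
  -- A window length for which one step shrinks the undisturbed error by a factor of four.
  obtain ⟨L, hL, hLsmall⟩ : ∃ L : ℝ, 0 < L ∧ C * c * Real.exp (-(rate / 2 * L)) ≤ 1 / 4 := by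
    have h1 : Tendsto (fun L : ℝ => C * c * Real.exp (-(rate / 2 * L))) atTop (𝓝 (C * c * 0)) :=
      (Real.tendsto_exp_neg_atTop_nhds_zero.comp
        (tendsto_id.const_mul_atTop (half_pos hrate))).const_mul _
    rw [mul_zero] at h1
    obtain ⟨L, h2, h3⟩ := ((h1.eventually (gt_mem_nhds (show (0 : ℝ) < 1 / 4 by norm_num))).and
      (eventually_gt_atTop 0)).exists
    exact ⟨L, h3, h2.le⟩
  obtain ⟨B, hB⟩ := (isCompact_Icc (a := 0) (b := L)).exists_bound_of_continuousOn
    (f := fun s : ℝ => NormedSpace.exp ((-s) • R))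
    (fun s _ => ((hasDerivAt_exp_smul_const R (-s)).continuousAt.comp
      (f := fun s : ℝ => -s) continuous_neg.continuousAt).continuousWithinAt)
  have hB0 : 0 ≤ B := (norm_nonneg _).trans (hB 0 ⟨le_rfl, hL.le⟩)
  set E : ℝ → Fin N → Fin m → ℝ := fun s i => e i s with hE
  have hEc : ContinuousOn E (Ici 0) := continuousOn_pi.2 hec
  set K := ‖R‖ + μ * (D * 2) + Q + 1 with hK
  have hK0 : 0 < K := by positivity
  set K₁ := (1 + Q / K) * Real.exp (K * L) with hK₁
  have hK₁0 : 0 ≤ K₁ := by positivity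
  have hexp1 : ∀ s, 0 ≤ s → Real.exp (-κ * s) ≤ 1 := fun s hs =>
    Real.exp_le_one_iff.2 (by have := mul_nonneg hκ.le hs; linarith)
  -- Growth of the error within one window.
  have hgron : ∀ s₀, 0 ≤ s₀ → ∀ s ∈ Icc s₀ (s₀ + L), ‖E s‖ ≤ K₁ * (‖E s₀‖ + 1) := by
    intro s₀ hs₀ s hs
    have h := norm_le_gronwallBound_of_norm_deriv_right_le (f := E) (δ := ‖E s₀‖) (K := K)
      (ε := Q) (hEc.mono (fun s hs => hs₀.trans hs.1 : Icc s₀ (s₀ + L) ⊆ Ici 0))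
      (fun s hs => hasDerivWithinAt_pi.2 fun i => hed i s (hs₀.trans hs.1)) le_rfl
      (fun s hs => by
        have hs0 : 0 ≤ s := hs₀.trans hs.1
        refine (pi_norm_le_iff_of_nonneg (by positivity)).2 fun i => ?_
        have h1 : ‖e i s‖ ≤ ‖E s‖ := norm_le_pi_norm (E s) i
        have h2 : ‖S *ᵥ e i s‖ ≤ ‖R‖ * ‖E s‖ :=
          (R.le_opNorm (e i s)).trans (mul_le_mul_of_nonneg_left h1 (norm_nonneg _))
        have h3 : ‖d i s‖ ≤ Q * (‖E s‖ + 1) := by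
          refine (hd i s hs0).trans ?_
          have := mul_le_mul_of_nonneg_left (hexp1 s hs0) hQ
          rw [mul_one] at this
          gcongr
        have h4 := norm_consensus_le (ha s) (haD s) (E s) i
        have h5 := mul_le_mul_of_nonneg_left h4 hμ
        rw [← Real.norm_of_nonneg hμ, ← norm_smul, Real.norm_of_nonneg hμ] at h5
        refine (norm_add_le _ _).trans ((add_le_add h2 ((norm_add_le _ _).trans
          (add_le_add h3 h5))).trans ?_)
        have := norm_nonneg (E s)
        rw [hK]
        linarith) s hs
    refine h.trans ((gronwallBound_le hK0 hQ).trans ?_)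
    have h1 : Real.exp (K * (s - s₀)) ≤ Real.exp (K * L) := by
      have := hs.2
      gcongr
      linarith
    have h2 : ‖E s₀‖ + Q / K ≤ (1 + Q / K) * (‖E s₀‖ + 1) := by
      have : 0 ≤ Q / K * ‖E s₀‖ := by positivity
      linarith
    calc (‖E s₀‖ + Q / K) * Real.exp (K * (s - s₀))
        ≤ ((1 + Q / K) * (‖E s₀‖ + 1)) * Real.exp (K * L) := by gcongr
      _ = K₁ * (‖E s₀‖ + 1) := by rw [hK₁]; ring
  set H := C * Real.exp (rate / 2 * L) * (B * (Q * (K₁ + 1)) * L) with hH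
  have hstep : ∀ s₀, 0 ≤ s₀ →
      ‖E (s₀ + L)‖ ≤ 1 / 4 * ‖E s₀‖ + H * Real.exp (-κ * s₀) * (‖E s₀‖ + 1) := by
    intro s₀ hs₀
    have hH0 : 0 ≤ H := by positivity
    refine (pi_norm_le_iff_of_nonneg (by positivity)).2 fun i => ?_
    set Φ : ℝ → (Fin m → ℝ) →L[ℝ] (Fin m → ℝ) := fun s => NormedSpace.exp ((s₀ - s) • R) with hΦ
    set γ := B * (Q * Real.exp (-κ * s₀) * ((K₁ + 1) * (‖E s₀‖ + 1))) with hγ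
    have hγ0 : 0 ≤ γ := by positivity
    have hdist : ∀ i, ∀ s ∈ Ico s₀ (s₀ + L), ‖Φ s (d i s)‖ ≤ γ := fun i s hs => by
      have hs0 : 0 ≤ s := hs₀.trans hs.1
      refine ((Φ s).le_opNorm _).trans ?_
      have h1 : ‖Φ s‖ ≤ B := by
        have := hB (s - s₀) ⟨by linarith [hs.1], by linarith [hs.2]⟩
        rwa [neg_sub] at this
      have h2 : ‖d i s‖ ≤ Q * Real.exp (-κ * s₀) * ((K₁ + 1) * (‖E s₀‖ + 1)) := by
        refine (hd i s hs0).trans ?_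
        have h3 : ‖e i s‖ ≤ K₁ * (‖E s₀‖ + 1) :=
          (norm_le_pi_norm (E s) i).trans (hgron s₀ hs₀ s ⟨hs.1, hs.2.le⟩)
        have h4 : Real.exp (-κ * s) ≤ Real.exp (-κ * s₀) :=
          Real.exp_le_exp.2 (by have := mul_le_mul_of_nonneg_left hs.1 hκ.le; linarith)
        have h5 := norm_nonneg (E s₀)
        have h6 : ‖e i s‖ + 1 ≤ (K₁ + 1) * (‖E s₀‖ + 1) := by linarith
        gcongr
      exact mul_le_mul h1 h2 (norm_nonneg _) hB0
    have hζ : ‖Φ (s₀ + L) (e i (s₀ + L))‖ ≤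
        c * Real.exp (-rate * L) * ‖E s₀‖ + γ * L := by
      refine (pi_norm_le_iff_of_nonneg (by positivity)).2 fun l => ?_
      have h := hcons (fun i s => Φ s (e i s) l) (fun i s => Φ s (d i s) l) s₀ (s₀ + L) ‖E s₀‖ γ
        hs₀ (by linarith) (norm_nonneg _) hγ0 ?_ ?_
        (fun i s hs => (norm_le_pi_norm (Φ s (d i s)) l).trans (hdist i s hs))
        (fun i => by
          have : Φ s₀ = 1 := by simp [hΦ]
          rw [this]
          exact (norm_le_pi_norm (e i s₀) l).trans (norm_le_pi_norm (E s₀) i)) i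
      · rwa [add_sub_cancel_left] at h
      · intro i
        have hΦc : Continuous Φ := continuous_iff_continuousAt.2 fun s =>
          (hasDerivAt_exp_smul_const R (s₀ - s)).continuousAt.comp
            (f := fun s : ℝ => s₀ - s) (by fun_prop)
        exact continuousOn_pi.1 (hΦc.continuousOn.clm_apply
          ((hec i).mono fun s hs => hs₀.trans hs.1)) l
      · intro i s hs
        have h1 := HasDerivWithinAt.exp_neg_smul_apply R (s₀ := s₀) (hed i s (hs₀.trans hs.1))
        refine (hasDerivWithinAt_pi.1 h1 l).congr_deriv ?_
        rw [map_add, map_smul, map_sum, Pi.add_apply, Pi.smul_apply, Finset.sum_apply, add_comm,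
          smul_eq_mul]
        congr 2
        refine Finset.sum_congr rfl fun j _ => ?_
        rw [map_smul, map_sub, Pi.smul_apply, Pi.sub_apply, smul_eq_mul]
        congr 2
        refine Fin.cases ?_ (fun j => ?_) j
        · simp
        · simp [hΦ]
    have hinv : e i (s₀ + L) = NormedSpace.exp (L • R) (Φ (s₀ + L) (e i (s₀ + L))) := by
      have h1 : NormedSpace.exp (L • R) * Φ (s₀ + L) = 1 := by
        have h2 : s₀ - (s₀ + L) = -L := by ring
        let _ : NormedAlgebra ℚ ((Fin m → ℝ) →L[ℝ] (Fin m → ℝ)) :=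
          NormedAlgebra.restrictScalars ℚ ℝ _
        simp only [hΦ, h2]
        rw [← NormedSpace.exp_add_of_commute
          (((Commute.refl R).smul_left L).smul_right (-L)), ← add_smul]
        simp
      have h3 := congrArg (fun f : (Fin m → ℝ) →L[ℝ] (Fin m → ℝ) => f (e i (s₀ + L))) h1
      exact h3.symm
    have h1 := hflow L hL.le (Φ (s₀ + L) (e i (s₀ + L)))
    rw [← hinv] at h1
    have hsplit : Real.exp (rate / 2 * L) * Real.exp (-rate * L)
        = Real.exp (-(rate / 2 * L)) := by
      rw [← Real.exp_add]; ring_nf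
    calc ‖E (s₀ + L) i‖
        ≤ C * Real.exp (rate / 2 * L) * (c * Real.exp (-rate * L) * ‖E s₀‖ + γ * L) :=
          h1.trans (mul_le_mul_of_nonneg_left hζ (by positivity))
      _ = C * c * (Real.exp (rate / 2 * L) * Real.exp (-rate * L)) * ‖E s₀‖
          + H * Real.exp (-κ * s₀) * (‖E s₀‖ + 1) := by rw [hH, hγ]; ring
      _ ≤ _ := by
          rw [hsplit]
          gcongr
  have hlim : Tendsto (fun s => ‖E s‖) atTop (𝓝 0) := by
    refine tendsto_zero_of_step_contraction (ψ := fun s => H * Real.exp (-κ * s)) hL hEc.norm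
      (fun s => norm_nonneg _) ?_ hstep
    have h1 : Tendsto (fun s : ℝ => H * Real.exp (-(κ * s))) atTop (𝓝 (H * 0)) :=
      (Real.tendsto_exp_neg_atTop_nhds_zero.comp (tendsto_id.const_mul_atTop hκ)).const_mul _
    simpa using h1
  exact tendsto_pi_nhds.1 (tendsto_zero_iff_norm_tendsto_zero.2 hlim) i

end Perturbation

/-! ### The adaptive distributed observer -/

/-- The norm induced by the Euclidean norm is equivalent to the largest entry. -/
lemma Matrix.exists_norm_equiv_entries (ι κ : Type*) [Fintype ι] [Fintype κ] [DecidableEq ι]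
    [DecidableEq κ] : ∃ K : ℝ, 0 < K ∧ ∀ M : Matrix ι κ ℝ,
      (∀ i j, |M i j| ≤ K * ‖M‖) ∧ ∀ r, (∀ i j, |M i j| ≤ r) → 0 ≤ r → ‖M‖ ≤ K * r := by
  let B : ι × κ → ℝ := fun x =>
    ‖LinearMap.toContinuousLinearMap (Matrix.entryLinearMap ℝ ℝ x.1 x.2)‖
  let B' : ι × κ → ℝ := fun x => ‖Matrix.single x.1 x.2 (1 : ℝ)‖
  have hB : ∀ x, 0 ≤ B x := fun x =>
    norm_nonneg (LinearMap.toContinuousLinearMap (Matrix.entryLinearMap ℝ ℝ x.1 x.2))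
  have hB' : ∀ x, 0 ≤ B' x := fun x => norm_nonneg _
  have h1 : 0 ≤ ∑ x, B x := Finset.sum_nonneg fun x _ => hB x
  have h2 : 0 ≤ ∑ x, B' x := Finset.sum_nonneg fun x _ => hB' x
  refine ⟨∑ x, B x + ∑ x, B' x + 1, by positivity, fun M => ⟨fun i j => ?_, fun r hM hr => ?_⟩⟩
  · have h3 : |M i j| ≤ B (i, j) * ‖M‖ :=
      (LinearMap.toContinuousLinearMap (Matrix.entryLinearMap ℝ ℝ i j)).le_opNorm M
    have h4 : B (i, j) ≤ ∑ x, B x :=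
      Finset.single_le_sum (fun x _ => hB x) (Finset.mem_univ (i, j))
    exact h3.trans (mul_le_mul_of_nonneg_right (by linarith) (norm_nonneg _))
  · calc ‖M‖ = ‖∑ x : ι × κ, M x.1 x.2 • Matrix.single x.1 x.2 (1 : ℝ)‖ := by
          conv_lhs => rw [Matrix.matrix_eq_sum_single M]
          rw [← Finset.univ_product_univ, Finset.sum_product]
          simp [Matrix.smul_single]
      _ ≤ ∑ x, B' x * r := by
          refine (norm_sum_le _ _).trans (Finset.sum_le_sum fun x _ => ?_)
          rw [norm_smul, mul_comm]
          exact mul_le_mul_of_nonneg_left (hM _ _) (hB' x)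
      _ ≤ _ := by
          rw [← Finset.sum_mul]
          exact mul_le_mul_of_nonneg_right (by linarith) hr

lemma Matrix.norm_mulVec_le_of_entries {m : ℕ} {M : Matrix (Fin m) (Fin m) ℝ} {r : ℝ}
    (hr : 0 ≤ r) (hM : ∀ i j, |M i j| ≤ r) (w : Fin m → ℝ) : ‖M *ᵥ w‖ ≤ m * r * ‖w‖ := by
  refine (pi_norm_le_iff_of_nonneg (by positivity)).2 fun i => ?_
  calc ‖∑ j, M i j * w j‖ ≤ ∑ j, ‖M i j * w j‖ := norm_sum_le _ _
    _ ≤ ∑ _j : Fin m, r * ‖w‖ := by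
        refine Finset.sum_le_sum fun j _ => ?_
        rw [norm_mul]
        exact mul_le_mul (hM i j) (norm_le_pi_norm w j) (norm_nonneg _) hr
    _ = m * r * ‖w‖ := by simp [mul_assoc]

lemma HasDerivWithinAt.matrix_entry {m : ℕ} {X : ℝ → Matrix (Fin m) (Fin m) ℝ}
    {Y : Matrix (Fin m) (Fin m) ℝ} {u : Set ℝ} {s : ℝ} (h : HasDerivWithinAt X Y u s)
    (k l : Fin m) : HasDerivWithinAt (fun s => X s k l) (Y k l) u s :=
  (LinearMap.toContinuousLinearMap
    (Matrix.entryLinearMap ℝ ℝ k l)).hasFDerivAt.comp_hasDerivWithinAt s h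

section Observer

variable {N m : ℕ} {a : ℝ → Matrix (Fin (N + 1)) (Fin (N + 1)) ℝ} {μ₁ μ₂ : ℝ}
  {S : Matrix (Fin m) (Fin m) ℝ} {v : ℝ → Fin m → ℝ}
  {X : Fin N → ℝ → Matrix (Fin m) (Fin m) ℝ} {η : Fin N → ℝ → Fin m → ℝ}

/-- Each entry of the estimation errors `X i - S` follows the scalar consensus dynamics. -/
lemma IsObserverTrajectory.abs_entry_le (h : IsObserverTrajectory a μ₁ μ₂ S v X η) {c rate : ℝ}
    (hcons : HasConsensusBound a μ₁ c rate) {M : ℝ} (hM : 0 ≤ M)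
    (h0 : ∀ i k l, |(X i 0 - S) k l| ≤ M) {s : ℝ} (hs : 0 ≤ s) (i : Fin N) (k l : Fin m) :
    |(X i s - S) k l| ≤ c * Real.exp (-rate * s) * M := by
  have := hcons (fun i s => (X i s - S) k l) (fun _ _ => 0) 0 s M 0 le_rfl hs hM le_rfl
    (fun i => ((LinearMap.toContinuousLinearMap
      (Matrix.entryLinearMap ℝ ℝ k l)).continuous.comp_continuousOn
        (((h.estimate i).1.sub continuousOn_const).mono fun s hs => hs.1)))
    (fun i s hs => by
      have h1 := (((h.estimate i).2 s hs.1).sub_const S).matrix_entry k l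
      refine h1.congr_deriv ?_
      change (μ₁ • ∑ j : Fin (N + 1), a s i.succ j •
        ((Fin.cons S fun k => X k s : Fin (N + 1) → Matrix (Fin m) (Fin m) ℝ) j - X i s)) k l = _
      rw [add_zero, Matrix.smul_apply, Matrix.sum_apply, smul_eq_mul]
      congr 1
      refine Finset.sum_congr rfl fun j _ => ?_
      rw [Matrix.smul_apply, smul_eq_mul]
      congr 1
      refine Fin.cases ?_ (fun j => ?_) j
      · simp
      · simp)
    (fun _ _ _ => by simp) (fun i => h0 i k l) i
  simpa using this

/-- The observation error is driven by the term `(X i - S) η i`. -/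
lemma IsObserverTrajectory.hasDerivWithinAt_error (h : IsObserverTrajectory a μ₁ μ₂ S v X η)
    (i : Fin N) {s : ℝ} (hs : 0 ≤ s) :
    HasDerivWithinAt (fun s => η i s - v s) (S *ᵥ (η i s - v s) +
      ((X i s - S) *ᵥ η i s + μ₂ • ∑ j : Fin (N + 1), a s i.succ j •
        ((Fin.cons 0 fun k => η k s - v s : Fin (N + 1) → Fin m → ℝ) j - (η i s - v s))))
      (Ici s) s := by
  refine (((h.observer i).2 s hs).sub (h.leader.2 s hs)).congr_deriv ?_
  have e : ∑ j : Fin (N + 1), a s i.succ j •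
        ((Fin.cons 0 fun k => η k s - v s : Fin (N + 1) → Fin m → ℝ) j - (η i s - v s)) =
      ∑ j : Fin (N + 1), a s i.succ j •
        ((Fin.cons (v s) fun k => η k s : Fin (N + 1) → Fin m → ℝ) j - η i s) := by
    refine Finset.sum_congr rfl fun j _ => ?_
    congr 1
    refine Fin.cases ?_ (fun j => ?_) j
    · simp
    · simp
  rw [e, Matrix.mulVec_sub, Matrix.sub_mulVec]
  beta_reduce
  abel

end Observer

theorem lemma1 {N m n₀ : ℕ} (S : Matrix (Fin m) (Fin m) ℝ) (hS : NoEigenvalueWithPosRe S)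
    (G : Fin n₀ → Digraph (Fin (N + 1)))
    (A : Fin n₀ → Matrix (Fin (N + 1)) (Fin (N + 1)) ℝ)
    (hA : ∀ p, IsWeightedAdjacency (G p) (A p))
    (σ : ℝ → Fin n₀) (t : ℕ → ℝ) (hσ : IsSwitchingSignal σ t)
    (hG : IsJointlyConnected G σ t)
    (μ₁ μ₂ : ℝ) (hμ₁ : 0 < μ₁) (hμ₂ : 0 < μ₂) :
    ∃ c rate : ℝ, 0 < c ∧ 0 < rate ∧
      ∀ (v : ℝ → Fin m → ℝ) (X : Fin N → ℝ → Matrix (Fin m) (Fin m) ℝ)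
        (η : Fin N → ℝ → Fin m → ℝ),
        IsObserverTrajectory (fun s => A (σ s)) μ₁ μ₂ S v X η →
          (∀ s : ℝ, 0 ≤ s → ‖blockCol fun i => X i s - S‖ ≤
            c * ‖blockCol fun i => X i 0 - S‖ * Real.exp (-rate * s)) ∧
          ∀ i, Tendsto (fun s => η i s - v s) atTop (𝓝 0) := by
  obtain ⟨c₁, r₁, hc₁, hr₁, hcons₁⟩ := exists_hasConsensusBound hA hσ hG hμ₁
  obtain ⟨c₂, r₂, hc₂, hr₂, hcons₂⟩ := exists_hasConsensusBound hA hσ hG hμ₂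
  obtain ⟨D, hD, hAD⟩ := exists_row_sum_le A
  obtain ⟨K, hK, hnorm⟩ := Matrix.exists_norm_equiv_entries (Fin N × Fin m) (Fin m)
  obtain ⟨C, hC, hgrow⟩ := hS.exists_norm_solution_le (half_pos hr₁)
  refine ⟨K * c₁ * K, r₁, by positivity, hr₁, fun v X η h => ?_⟩
  set M := K * ‖blockCol fun i => X i 0 - S‖ with hM
  have hM0 : 0 ≤ M := by positivity
  have hX : ∀ s, 0 ≤ s → ∀ i k l, |(X i s - S) k l| ≤ c₁ * Real.exp (-r₁ * s) * M :=
    fun s hs i k l => h.abs_entry_le hcons₁ hM0 (fun i k l => (hnorm (blockCol fun i => X i 0 - S)).1 (i, k) l) hs i k l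
  refine ⟨fun s hs => ?_, fun i => ?_⟩
  · refine ((hnorm (blockCol fun i => X i s - S)).2 _ (fun x l => hX s hs x.1 x.2 l) (by positivity)).trans (le_of_eq ?_)
    rw [hM]
    ring
  -- The leader grows at rate at most `r₁ / 2`, half the decay rate of `X i - S`.
  refine tendsto_zero_of_vanishing_disturbance hS (fun s => (hA (σ s)).nonneg) hD
    (fun s => hAD (σ s)) hμ₂.le hc₂ hr₂ hcons₂ (Q := m * (c₁ * M) * (1 + C * ‖v 0‖))
    (by positivity) (half_pos hr₁) (e := fun i s => η i s - v s)
    (d := fun i s => (X i s - S) *ᵥ η i s)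
    (fun i => (h.observer i).1.sub h.leader.1) (fun i s hs => h.hasDerivWithinAt_error i hs)
    (fun i s hs => ?_) i
  have h1 := Matrix.norm_mulVec_le_of_entries (by positivity) (hX s hs i) (η i s)
  refine h1.trans ?_
  have h2 : ‖η i s‖ ≤ ‖η i s - v s‖ + C * Real.exp (r₁ / 2 * s) * ‖v 0‖ := by
    calc ‖η i s‖ = ‖(η i s - v s) + v s‖ := by rw [sub_add_cancel]
      _ ≤ ‖η i s - v s‖ + ‖v s‖ := norm_add_le _ _
      _ ≤ _ := by gcongr; exact hgrow v h.leader s hs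
  have hE : 1 ≤ Real.exp (r₁ / 2 * s) := Real.one_le_exp (by positivity)
  have h3 : ‖η i s‖ ≤ Real.exp (r₁ / 2 * s) * ((1 + C * ‖v 0‖) * (‖η i s - v s‖ + 1)) := by
    have h4 : ‖η i s - v s‖ ≤ Real.exp (r₁ / 2 * s) * ‖η i s - v s‖ :=
      le_mul_of_one_le_left (norm_nonneg _) hE
    have h5 : 0 ≤ Real.exp (r₁ / 2 * s) * (1 + C * ‖v 0‖ * ‖η i s - v s‖) := by positivity
    linarith
  have hsplit : Real.exp (-r₁ * s) * Real.exp (r₁ / 2 * s) = Real.exp (-(r₁ / 2) * s) := by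
    rw [← Real.exp_add]; ring_nf
  calc m * (c₁ * Real.exp (-r₁ * s) * M) * ‖η i s‖
      ≤ m * (c₁ * Real.exp (-r₁ * s) * M) *
          (Real.exp (r₁ / 2 * s) * ((1 + C * ‖v 0‖) * (‖η i s - v s‖ + 1))) := by gcongr
    _ = m * (c₁ * M) * (1 + C * ‖v 0‖) * (Real.exp (-r₁ * s) * Real.exp (r₁ / 2 * s)) *
          (‖η i s - v s‖ + 1) := by ring
    _ = _ := by rw [hsplit]
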